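/- Let $n\ge 4$, let $G=\mathsf C_{2^n}=\mathbb Z/2^n\mathbb Z$ (written additively), let $\rho(g)\colon x\mapsto x+g$ be the right regular representation, and let $\mathrm{Hol}(G)=\langle\rho(G),\mathrm{Aut}(G)\rangle\le \mathrm{Sym}(G)$. The local normalizing graph of $G$ has as vertices the regular subgroups of $\mathrm{Hol}(G)$; two distinct vertices $N,M$ are joined by an edge if and only if $N$ and $M$ normalize each other in $\mathrm{Sym}(G)$. Permutations and automorphisms act on the right. A gamma function is a map $\gamma\colon G\to\mathrm{Aut}(G)$ with $\gamma(g^{\gamma(h)}+h)=\gamma(g)\gamma(h)$ for all $g,h\in G$; its associated subgroup is $\{\gamma(g)\rho(g): g\in G\}$. For odd $a$ let $\sigma_a\in\mathrm{Aut}(G)$ be $x\mapsto ax$. The following maps are gamma functions: $\gamma_1(x)=\sigma_1$, $\gamma_2(x)=\sigma_{2^{n-1}+1}^x$, $\gamma_3(x)=\sigma_{2^{n-1}-1}^x$, $\gamma_4(x)=\sigma_{2^n-1}^x$; $\gamma_5(x)=\sigma_1,\sigma_{2^{n-1}-1},\sigma_{2^{n-1}+1},\sigma_{2^n-1}$ and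 $\gamma_6(x)=\sigma_1,\sigma_{2^n-1},\sigma_{2^{n-1}+1},\sigma_{2^{n-1}-1}$ for $x\equiv 0,1,2,3 \pmod 4$ respectively; $\gamma_{\mathsf p}(x)=\sigma_{2x+1}$; $\gamma_{\mathsf m}(x)=\sigma_{2x+1}$ for $x$ even and $\sigma_{2x+2^{n-2}+1}$ for $x$ odd; and $\gamma_{\mathsf c,u}(x)=\sigma_{2^ux+1}$ for $2\le u\le n$. Let $N_1,\dots,N_6,N_{\mathsf p},N_{\mathsf m},N_{\mathsf c,u}$ be the associated subgroups. For an integer $k\ge 0$ let $N^k$ be the conjugate of $N$ under $\sigma_{2k+1}^{-1}$, and write $N_{\mathsf p}^k,N_{\mathsf m}^k,N_{\mathsf c,u}^k$ accordingly. **Vertices.** The regular subgroups of $\mathrm{Hol}(G)$ are exactly $N_1,\dots,N_6$, the $N_{\mathsf p}^k$, the $N_{\mathsf m}^k$ and the $N_{\mathsf c,u}^k$, where $0\le k<2^{n-1}$ and $2\le u\le n$. Each $N_{\mathsf c,u}^k$ is cyclic, and $N_{\mathsf c,n}^k=N_1$, $N_{\mathsf c,n-1}^k=N_2$ for all $k$.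 The groups $N_3,N_4,N_5,N_6$ are distinct, and the four families $\{N_3,\dots,N_6\}$, $\{N_{\mathsf p}^k\}$, $\{N_{\mathsf m}^k\}$, $\{N_{\mathsf c,u}^k\}$ are pairwise disjoint. Moreover $N_{\mathsf p}^k=N_{\mathsf p}^h$ if and only if $k\equiv h\pmod{2^{n-2}}$, the same holds for $N_{\mathsf m}$, and $N_{\mathsf c,u}^k=N_{\mathsf c,v}^h$ if and only if $u=v$ and either $u=n$ or $k\equiv h\pmod{2^{n-u-1}}$. **Edges.** Two distinct vertices are joined by an edge if and only if they lie together in one of the following sets (which are therefore cliques): 1. $\{N_1,N_2,N_3,N_4\}$ and $\{N_3,N_4,N_5,N_6\}$; 2. $H=\{N_{\mathsf c,u}^k:\ \lceil n/2\rceil\le u\le n,\ 0\le k<2^{n-1}\}$, which contains $N_1$ and $N_2$ and has exactly $2^{n-\lceil n/2\rceil}$ elements; 3. $S_k=\{N_{\mathsf p}^{k},\,N_{\mathsf m}^{k+2^{n-4}},\,N_{\mathsf p}^{k+2^{n-3}},\,N_{\mathsf m}^{k+2^{n-3}+2^{n-4}}\}$ for $0\le k<2^{n-1}$, each with exactly $4$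 elements; 4. $A_u^t=\{N_{\mathsf c,u}^k:\ 0\le k<2^{n-1},\ k\equiv t\pmod{2^{n-2u-1}}\}$ for $2\le u<\lceil n/2\rceil$ and $0\le t<2^{n-2u-1}$, each with exactly $2^u$ elements. -/

import Mathlib

namespace CyclicHol

open Equiv

section General

variable {G : Type*} [AddGroup G]

/-- The permutational holomorph of a group `G` (written additively): the subgroup of `Sym(G)`
generated by the right translations `x ↦ x + g` and the automorphisms of `G`. -/
def hol (G : Type*) [AddGroup G] : Subgroup (Perm G) :=
  Subgroup.closure
    (Set.range (fun g : G => Equiv.addRight g) ∪ Set.range (fun α : G ≃+ G => α.toEquiv))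

/-- A permutation group on `X` is regular if for all `x`, `y` exactly one of its elements
maps `x` to `y`. -/
def IsRegularSubgroup {X : Type*} (N : Subgroup (Perm X)) : Prop :=
  ∀ x y : X, ∃! f : Perm X, f ∈ N ∧ f x = y

/-- The vertices of the local normalizing graph: the regular subgroups of the holomorph. -/
def regularSubgroups (G : Type*) [AddGroup G] : Set (Subgroup (Perm G)) :=
  {N | N ≤ hol G ∧ IsRegularSubgroup N}

/-- The local normalizing graph of `G`: two distinct regular subgroups of the holomorph are joined
by an edge if and only if they normalize each other in `Sym(G)`. -/
def localNormalizingGraph (G : Type*) [AddGroup G] : SimpleGraph (regularSubgroups G) where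
  Adj N M := N ≠ M ∧ N.1 ≤ Subgroup.normalizer (M.1 : Set (Perm G)) ∧
    M.1 ≤ Subgroup.normalizer (N.1 : Set (Perm G))
  symm := ⟨fun _ _ h => ⟨h.1.symm, h.2.2, h.2.1⟩⟩
  loopless := ⟨fun _ h => h.1 rfl⟩

/-- The gamma functional equation `γ(g^{γ(h)} + h) = γ(g) γ(h)`. Automorphisms act on the right, so
the product `γ(g) γ(h)` is `γ(g)` followed by `γ(h)`. -/
def IsGammaFunction (γ : G → (G ≃+ G)) : Prop :=
  ∀ g h : G, γ (γ h g + h) = (γ g).trans (γ h)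

/-- The permutation `ν(g) = γ(g) ρ(g)`, that is `x ↦ x^{γ(g)} + g`. -/
def nu (γ : G → (G ≃+ G)) (g : G) : Perm G :=
  (γ g).toEquiv.trans (Equiv.addRight g)

theorem nu_apply (γ : G → (G ≃+ G)) (g x : G) : nu γ g x = γ g x + g := rfl

/-- The subgroup of `Sym(G)` associated with `γ`. It is generated by the permutations `ν(g)`, and
consists exactly of them when `γ` is a gamma function (see `coe_assocSubgroup`). -/
def assocSubgroup (γ : G → (G ≃+ G)) : Subgroup (Perm G) :=
  Subgroup.closure (Set.range (nu γ))

theorem coe_assocSubgroup {γ : G → (G ≃+ G)} (hγ : IsGammaFunction γ) :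
    (assocSubgroup γ : Set (Perm G)) = Set.range (nu γ) := by
  have hmul : ∀ g h, nu γ h * nu γ g = nu γ (γ h g + h) := by
    intro g h
    ext x
    rw [Perm.mul_apply, nu_apply, nu_apply, nu_apply, hγ g h, map_add, add_assoc]
    rfl
  have h0 : nu γ 0 = 1 := by
    have h := hmul 0 0
    rw [map_zero, add_zero] at h
    exact mul_eq_right.mp h
  have hinv : ∀ g, ∃ g', nu γ g' = (nu γ g)⁻¹ := by
    intro g
    refine ⟨(γ g).symm (-g), ?_⟩
    rw [eq_inv_iff_mul_eq_one, ← inv_eq_iff_mul_eq_one, inv_eq_iff_mul_eq_one, mul_eq_one_iff_eq_inv,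
      eq_inv_iff_mul_eq_one.trans (mul_eq_one_comm)]
    rw [hmul, AddEquiv.apply_symm_apply, neg_add_cancel, h0]
  let S : Subgroup (Perm G) :=
    { carrier := Set.range (nu γ)
      mul_mem' := by
        rintro _ _ ⟨h, rfl⟩ ⟨g, rfl⟩
        exact ⟨_, (hmul g h).symm⟩
      one_mem' := ⟨0, h0⟩
      inv_mem' := by
        rintro _ ⟨g, rfl⟩
        exact hinv g }
  have : assocSubgroup γ = S := Subgroup.closure_eq S
  rw [this]
  rfl

/-- The conjugate `N^α = α⁻¹ N α` of a permutation group under an automorphism `α` of `G`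
(permutations act on the right, so `α⁻¹ n α` is the function `x ↦ α (n (α⁻¹ x))`). -/
def conjSubgroup (N : Subgroup (Perm G)) (α : G ≃+ G) : Subgroup (Perm G) :=
  N.map (MulAut.conj α.toEquiv).toMonoidHom

end General

/-- The cyclic group `C_{2^n}`, written additively. -/
abbrev C (n : ℕ) : Type := ZMod (2 ^ n)

open Classical in
/-- The automorphism `σ_a : x ↦ a x` of `C_{2^n}`, for `a` odd (a unit). It is only used for such
`a`; the value at non-units is irrelevant. -/
noncomputable def sigma {n : ℕ} (a : C n) : C n ≃+ C n :=
  if h : IsUnit a then DistribMulAction.toAddEquiv (C n) h.unit else AddEquiv.refl _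

theorem sigma_apply {n : ℕ} {a : C n} (h : IsUnit a) (x : C n) : sigma a x = a * x := by
  unfold sigma
  rw [dif_pos h]
  rfl

/-! The gamma functions. Note `σ_a^x = σ_{a^x}`. -/

noncomputable def gamma1 (n : ℕ) (_x : C n) : C n ≃+ C n := sigma 1

noncomputable def gamma2 (n : ℕ) (x : C n) : C n ≃+ C n := sigma ((2 ^ (n - 1) + 1) ^ x.val)

noncomputable def gamma3 (n : ℕ) (x : C n) : C n ≃+ C n := sigma ((2 ^ (n - 1) - 1) ^ x.val)

noncomputable def gamma4 (n : ℕ) (x : C n) : C n ≃+ C n := sigma ((2 ^ n - 1) ^ x.val)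

noncomputable def gamma5 (n : ℕ) (x : C n) : C n ≃+ C n :=
  match x.val % 4 with
  | 0 => sigma 1
  | 1 => sigma (2 ^ (n - 1) - 1)
  | 2 => sigma (2 ^ (n - 1) + 1)
  | _ => sigma (2 ^ n - 1)

noncomputable def gamma6 (n : ℕ) (x : C n) : C n ≃+ C n :=
  match x.val % 4 with
  | 0 => sigma 1
  | 1 => sigma (2 ^ n - 1)
  | 2 => sigma (2 ^ (n - 1) + 1)
  | _ => sigma (2 ^ (n - 1) - 1)

noncomputable def gammaP (n : ℕ) (x : C n) : C n ≃+ C n := sigma (2 * x + 1)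

noncomputable def gammaM (n : ℕ) (x : C n) : C n ≃+ C n :=
  if x.val % 2 = 0 then sigma (2 * x + 1) else sigma (2 * x + 2 ^ (n - 2) + 1)

noncomputable def gammaC (n u : ℕ) (x : C n) : C n ≃+ C n := sigma (2 ^ u * x + 1)

/-! The associated subgroups of `Sym(C_{2^n})`. -/

noncomputable def N1 (n : ℕ) : Subgroup (Perm (C n)) := assocSubgroup (gamma1 n)
noncomputable def N2 (n : ℕ) : Subgroup (Perm (C n)) := assocSubgroup (gamma2 n)
noncomputable def N3 (n : ℕ) : Subgroup (Perm (C n)) := assocSubgroup (gamma3 n)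
noncomputable def N4 (n : ℕ) : Subgroup (Perm (C n)) := assocSubgroup (gamma4 n)
noncomputable def N5 (n : ℕ) : Subgroup (Perm (C n)) := assocSubgroup (gamma5 n)
noncomputable def N6 (n : ℕ) : Subgroup (Perm (C n)) := assocSubgroup (gamma6 n)

/-- `N^k` is the conjugate of `N` under `σ_{2k+1}⁻¹`. -/
noncomputable def conjK {n : ℕ} (N : Subgroup (Perm (C n))) (k : ℕ) : Subgroup (Perm (C n)) :=
  conjSubgroup N (sigma (2 * (k : C n) + 1)).symm

noncomputable def NP (n k : ℕ) : Subgroup (Perm (C n)) := conjK (assocSubgroup (gammaP n)) k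
noncomputable def NM (n k : ℕ) : Subgroup (Perm (C n)) := conjK (assocSubgroup (gammaM n)) k
noncomputable def NC (n u k : ℕ) : Subgroup (Perm (C n)) := conjK (assocSubgroup (gammaC n u)) k

def familyP (n : ℕ) : Set (Subgroup (Perm (C n))) := {N | ∃ k < 2 ^ (n - 1), N = NP n k}
def familyM (n : ℕ) : Set (Subgroup (Perm (C n))) := {N | ∃ k < 2 ^ (n - 1), N = NM n k}
def familyC (n : ℕ) : Set (Subgroup (Perm (C n))) :=
  {N | ∃ u k, 2 ≤ u ∧ u ≤ n ∧ k < 2 ^ (n - 1) ∧ N = NC n u k}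

/-- `⌈n / 2⌉`. -/
def ceilHalf (n : ℕ) : ℕ := (n + 1) / 2

/-! The cliques. -/

def cliqueH (n : ℕ) : Set (Subgroup (Perm (C n))) :=
  {N | ∃ u k, ceilHalf n ≤ u ∧ u ≤ n ∧ k < 2 ^ (n - 1) ∧ N = NC n u k}

def cliqueS (n k : ℕ) : Set (Subgroup (Perm (C n))) :=
  {NP n k, NM n (k + 2 ^ (n - 4)), NP n (k + 2 ^ (n - 3)), NM n (k + 2 ^ (n - 3) + 2 ^ (n - 4))}

def cliqueA (n u t : ℕ) : Set (Subgroup (Perm (C n))) :=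
  {N | ∃ k < 2 ^ (n - 1), k ≡ t [MOD 2 ^ (n - 2 * u - 1)] ∧ N = NC n u k}

/-- All the listed cliques. -/
def cliques (n : ℕ) : Set (Set (Subgroup (Perm (C n)))) :=
  {{N1 n, N2 n, N3 n, N4 n}, {N3 n, N4 n, N5 n, N6 n}, cliqueH n} ∪
    {S | ∃ k < 2 ^ (n - 1), S = cliqueS n k} ∪
    {A | ∃ u t, 2 ≤ u ∧ u < ceilHalf n ∧ t < 2 ^ (n - 2 * u - 1) ∧ A = cliqueA n u t}

end CyclicHol

open CyclicHol

namespace CyclicHol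
open Equiv

variable {n : ℕ}

/-! Elements of the holomorph are affine maps x ↦ ax + b with a a unit, so a regular subgroup
contains exactly one map x ↦ c(g)x + g for each g, and closure under composition is the gamma
equation c(c(h)g + h) = c(g)c(h). The theorem is thus about such functions c (`IsMultiplier`). If
c(1) ≡ 1 mod 4, the powers of x ↦ c(1)x + 1 carry 0 to every point, so the group is cyclic and c is
affine. If c(1) ≡ 3 mod 4, then c(2) ≡ 1 mod 4, and the same argument applied to x ↦ c(2x) makes c
affine on evens and on odds with a common slope. Either way c(x) = 1 + βx + ω·parity(x), and the
gamma equation becomes 2βω = 0 and ω(ω + β + 2) = 0. With q = 2^(n-4), the solutions (ω, β) can be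
taken to be (0, 4t) for the cyclic groups, (0, 2·odd) for the P family, (4q, 2·odd) for the M
family, and (8qj - 2 - 4qi, 4qi) with i, j in {0, 1} for N3 to N6 (`IsMultiplier.classification`).
Two pairs give the same group iff 2(β - β') = 0 and β + ω = β' + ω'. The group of (ω', β')
normalizes that of (ω, β) iff 2βω' = 0 and β((β' + ω') - (β + ω)) = 0
(`IsAdmissible.le_normalizer_iff`). The edges then follow from a check over pairs of families,
cancelling odd factors. -/

/-! ### Arithmetic in Z/2^n. -/

theorem two_pow_self_eq_zero (n : ℕ) : (2 : C n) ^ n = 0 := by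
  exact_mod_cast ZMod.natCast_self (2 ^ n)

theorem two_pow_mul_natCast_eq_iff (j k h : ℕ) :
    (2 : C n) ^ j * k = 2 ^ j * h ↔ k ≡ h [MOD 2 ^ (n - j)] := by
  have e : (2 : C n) ^ j * k = 2 ^ j * h ↔ 2 ^ j * k ≡ 2 ^ j * h [MOD 2 ^ n] := by
    rw [← ZMod.natCast_eq_natCast_iff]
    push_cast
    rfl
  rw [e]
  rcases le_total j n with hj | hj
  · obtain ⟨i, rfl⟩ := Nat.exists_eq_add_of_le hj
    rw [pow_add, Nat.ModEq.mul_left_cancel_iff' (by positivity), Nat.add_sub_cancel_left]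
  -- Here the subtraction truncates: the modulus is 1 and both products vanish.
  · rw [Nat.sub_eq_zero_of_le hj, pow_zero]
    refine iff_of_true ?_ (Nat.modEq_one)
    have : 2 ^ n ∣ 2 ^ j := pow_dvd_pow 2 hj
    exact ((Nat.modEq_zero_iff_dvd.2 (this.mul_right k))).trans
      (Nat.modEq_zero_iff_dvd.2 (this.mul_right h)).symm

theorem two_pow_ne_zero {j : ℕ} (hj : j < n) : (2 : C n) ^ j ≠ 0 := by
  intro h
  have h1 := (two_pow_mul_natCast_eq_iff (n := n) j 1 0).1 (by simp [h])
  have h2 : 2 ^ (n - j) ∣ 1 := (Nat.modEq_zero_iff_dvd).1 h1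
  have h3 : 2 ^ (n - j) ≠ 1 := by
    simp; omega
  exact h3 (Nat.dvd_one.1 h2)

theorem exists_natCast_lt (x : C n) : ∃ k : ℕ, k < 2 ^ n ∧ x = (k : C n) :=
  ⟨x.val, ZMod.val_lt x, by simp⟩

theorem even_or_odd (x : C n) : (∃ y, x = 2 * y) ∨ ∃ y, x = 2 * y + 1 := by
  obtain ⟨k, -, rfl⟩ := exists_natCast_lt x
  rcases Nat.even_or_odd' k with ⟨j, rfl | rfl⟩
  · exact .inl ⟨j, by push_cast; rfl⟩
  · exact .inr ⟨j, by push_cast; rfl⟩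

theorem isUnit_two_mul_add_one (t : C n) : IsUnit (2 * t + 1) := by
  apply IsNilpotent.isUnit_add_one
  exact ⟨n, by rw [mul_pow, two_pow_self_eq_zero, zero_mul]⟩

theorem eq_zero_of_mul_odd {x : C n} (t : C n) (h : x * (2 * t + 1) = 0) : x = 0 :=
  (isUnit_two_mul_add_one t).mul_left_eq_zero.1 h

theorem exists_mul_odd_eq (t x : C n) : ∃ y, (2 * t + 1) * y = x := by
  obtain ⟨u, hu⟩ := isUnit_two_mul_add_one t
  exact ⟨↑u⁻¹ * x, by rw [← hu, Units.mul_inv_cancel_left]⟩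

theorem not_even_and_odd (hn : 1 ≤ n) (x y : C n) : 2 * x ≠ 2 * y + 1 := by
  intro h
  have h1 := isUnit_two_mul_add_one y
  rw [← h] at h1
  have h2 : IsUnit (2 : C n) := isUnit_of_mul_isUnit_left h1
  have h3 := h2.pow n
  rw [two_pow_self_eq_zero] at h3
  have : Fact (1 < 2 ^ n) := ⟨Nat.one_lt_two_pow (by omega)⟩
  exact not_isUnit_zero h3

theorem exists_odd_of_isUnit (hn : 1 ≤ n) {x : C n} (hx : IsUnit x) : ∃ y, x = 2 * y + 1 := by
  rcases even_or_odd x with ⟨y, rfl⟩ | h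
  · obtain ⟨z, hz⟩ := hx.exists_right_inv
    exact (not_even_and_odd hn (y * z) 0 (by linear_combination hz)).elim
  · exact h

theorem exists_of_two_pow_mul_eq_zero {j : ℕ} {x : C n} (h : 2 ^ j * x = 0) :
    ∃ y, x = 2 ^ (n - j) * y := by
  obtain ⟨k, -, rfl⟩ := exists_natCast_lt x
  have h1 := (two_pow_mul_natCast_eq_iff (n := n) j k 0).1 (by simpa using h)
  obtain ⟨y, rfl⟩ := Nat.modEq_zero_iff_dvd.1 h1
  exact ⟨y, by push_cast; rfl⟩

/-- The element `2 ^ (n - 4)`. -/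
def quarterStep (n : ℕ) : C n := 2 ^ (n - 4)

/-- High powers of 2 are rewritten as multiples of q = `quarterStep n`, so that later computations
rest on the single relation 16q = 0. -/
theorem two_pow_sub_two (hn : 4 ≤ n) : (2 : C n) ^ (n - 2) = 4 * quarterStep n := by
  rw [quarterStep, show n - 2 = (n - 4) + 2 by omega, pow_add]; ring

theorem two_pow_sub_one (hn : 4 ≤ n) : (2 : C n) ^ (n - 1) = 8 * quarterStep n := by
  rw [quarterStep, show n - 1 = (n - 4) + 3 by omega, pow_add]; ring

theorem sixteen_mul_quarterStep (hn : 4 ≤ n) : 16 * quarterStep n = 0 := by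
  rw [quarterStep, ← two_pow_self_eq_zero n]
  have h : (2 : C n) ^ n = 2 ^ ((n - 4) + 4) := by rw [Nat.sub_add_cancel hn]
  rw [h, pow_add]
  ring

theorem eight_mul_quarterStep_ne_zero (hn : 4 ≤ n) : 8 * quarterStep n ≠ 0 := by
  rw [← two_pow_sub_one hn]
  exact two_pow_ne_zero (by omega)

theorem eight_ne_zero (hn : 4 ≤ n) : (8 : C n) ≠ 0 := by
  have := two_pow_ne_zero (n := n) (j := 3) (by omega)
  norm_num at this
  exact this

theorem eq_zero_or_eq_of_two_mul_eq_zero (hn : 4 ≤ n) {x : C n} (h : 2 * x = 0) :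
    x = 0 ∨ x = 8 * quarterStep n := by
  obtain ⟨y, rfl⟩ := exists_of_two_pow_mul_eq_zero (j := 1) (x := x) (by simpa using h)
  rw [two_pow_sub_one hn]
  rcases even_or_odd y with ⟨z, rfl⟩ | ⟨z, rfl⟩
  · left; linear_combination z * sixteen_mul_quarterStep hn
  · right; linear_combination z * sixteen_mul_quarterStep hn

theorem exists_of_four_mul_eq_zero (hn : 4 ≤ n) {x : C n} (h : 4 * x = 0) :
    ∃ y, x = 4 * quarterStep n * y := by
  obtain ⟨y, rfl⟩ := exists_of_two_pow_mul_eq_zero (j := 2) (x := x)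
    (by linear_combination h)
  rw [two_pow_sub_two hn]
  exact ⟨y, rfl⟩

/-- The parity of an element of `C n`, as an element `0` or `1` of `C n`. -/
def parity (x : C n) : C n := if x.val % 2 = 0 then 0 else 1

theorem val_mod_two_two_mul (hn : 1 ≤ n) (y : C n) : (2 * y).val % 2 = 0 := by
  by_contra h
  obtain ⟨j, hj⟩ : ∃ j, (2 * y).val = 2 * j + 1 := ⟨(2 * y).val / 2, by omega⟩
  refine not_even_and_odd hn y j ?_
  rw [← ZMod.natCast_zmod_val (2 * y), hj]
  push_cast; rfl

theorem val_mod_two_two_mul_add_one (hn : 1 ≤ n) (y : C n) : (2 * y + 1).val % 2 = 1 := by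
  by_contra h
  obtain ⟨j, hj⟩ : ∃ j, (2 * y + 1).val = 2 * j := ⟨(2 * y + 1).val / 2, by omega⟩
  refine not_even_and_odd hn j y ?_
  rw [← ZMod.natCast_zmod_val (2 * y + 1), hj]
  push_cast; rfl

theorem parity_two_mul (hn : 1 ≤ n) (y : C n) : parity (2 * y) = 0 := by
  rw [parity, if_pos (val_mod_two_two_mul hn y)]

theorem parity_two_mul_add_one (hn : 1 ≤ n) (y : C n) : parity (2 * y + 1) = 1 := by
  rw [parity, if_neg (by rw [val_mod_two_two_mul_add_one hn y]; decide)]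

/-! ### Regular subgroups of the holomorph as groups of affine maps. -/

theorem perm_inv_apply_self {X : Type*} (f : Perm X) (x : X) : f⁻¹ (f x) = x :=
  Perm.inv_eq_iff_eq.2 rfl

/-- A unit-valued function `c` on `C n` for which `x ↦ σ_{c x}` is a gamma function. -/
structure IsMultiplier (c : C n → C n) : Prop where
  isUnit : ∀ x, IsUnit (c x)
  map_circ : ∀ g h, c (c h * g + h) = c g * c h

/-- The subgroup of `Sym(C n)` associated with `x ↦ σ_{c x}`. -/
noncomputable def affineGroup (c : C n → C n) : Subgroup (Perm (C n)) :=
  assocSubgroup fun x => sigma (c x)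

theorem affineGroup_le_hol (c : C n → C n) : affineGroup c ≤ hol (C n) := by
  rw [affineGroup, assocSubgroup, Subgroup.closure_le]
  rintro _ ⟨g, rfl⟩
  have : nu (fun x => sigma (c x)) g =
      (Equiv.addRight g : Perm (C n)) * (sigma (c g)).toEquiv := rfl
  rw [this]
  exact mul_mem (Subgroup.subset_closure (.inl ⟨g, rfl⟩)) (Subgroup.subset_closure (.inr ⟨_, rfl⟩))

namespace IsMultiplier

variable {c c' : C n → C n}

theorem isGammaFunction (hc : IsMultiplier c) : IsGammaFunction fun x => sigma (c x) := by
  intro g h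
  ext x
  have hu := (hc.isUnit g).mul (hc.isUnit h)
  rw [AddEquiv.trans_apply]
  simp only [sigma_apply (hc.isUnit _), hc.map_circ, sigma_apply hu]
  ring

theorem mem_affineGroup (hc : IsMultiplier c) (f : Perm (C n)) :
    f ∈ affineGroup c ↔ ∃ g, ∀ x, f x = c g * x + g := by
  rw [affineGroup, ← SetLike.mem_coe, coe_assocSubgroup hc.isGammaFunction]
  constructor
  · rintro ⟨g, rfl⟩
    exact ⟨g, fun x => by rw [nu_apply, sigma_apply (hc.isUnit g)]⟩
  · rintro ⟨g, hg⟩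
    refine ⟨g, ?_⟩
    ext x
    rw [hg, nu_apply, sigma_apply (hc.isUnit g)]

theorem exists_mem_affineGroup (hc : IsMultiplier c) (g : C n) :
    ∃ f ∈ affineGroup c, ∀ x, f x = c g * x + g := by
  refine ⟨nu (fun x => sigma (c x)) g, ?_, ?_⟩
  · exact Subgroup.subset_closure ⟨g, rfl⟩
  · intro x
    rw [nu_apply, sigma_apply (hc.isUnit g)]

theorem affineGroup_inj (hc : IsMultiplier c) (hc' : IsMultiplier c') :
    affineGroup c = affineGroup c' ↔ c = c' := by
  refine ⟨fun h => ?_, fun h => by rw [h]⟩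
  funext g
  obtain ⟨f, hf, hfx⟩ := hc.exists_mem_affineGroup g
  rw [h, hc'.mem_affineGroup] at hf
  obtain ⟨g', hg'⟩ := hf
  have h0 := hg' 0
  have h1 := hg' 1
  rw [hfx] at h0 h1
  obtain rfl : g = g' := by linear_combination h0
  linear_combination h1

theorem map_zero (hc : IsMultiplier c) : c 0 = 1 := by
  have h := hc.map_circ 0 0
  rw [mul_zero, add_zero] at h
  exact (hc.isUnit 0).mul_left_cancel (by rw [← h, mul_one])

theorem isRegularSubgroup (hc : IsMultiplier c) : IsRegularSubgroup (affineGroup c) := by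
  -- every point is reached from zero, and only the identity fixes zero
  have htrans : ∀ y, ∃ f ∈ affineGroup c, f 0 = y := fun y => by
    obtain ⟨f, hf, h⟩ := hc.exists_mem_affineGroup y
    exact ⟨f, hf, by rw [h, mul_zero, zero_add]⟩
  have hfree : ∀ f ∈ affineGroup c, f 0 = 0 → f = 1 := fun f hf h0 => by
    obtain ⟨g, hg⟩ := (hc.mem_affineGroup f).1 hf
    have hg0 : g = 0 := by
      rw [hg] at h0
      simpa using h0
    ext x
    rw [hg, hg0, hc.map_zero, one_mul, add_zero, Perm.one_apply]
  intro x y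
  obtain ⟨a, ha, hax⟩ := htrans x
  obtain ⟨b, hb, hby⟩ := htrans y
  refine ⟨b * a⁻¹, ⟨mul_mem hb (inv_mem ha), ?_⟩, ?_⟩
  · rw [Perm.mul_apply, ← hax, perm_inv_apply_self, hby]
  · rintro f ⟨hf, hfx⟩
    have := hfree (b⁻¹ * f * a) (mul_mem (mul_mem (inv_mem hb) hf) ha)
      (by rw [Perm.mul_apply, Perm.mul_apply, hax, hfx, ← hby, perm_inv_apply_self])
    rw [eq_mul_inv_iff_mul_eq]
    rw [mul_assoc, inv_mul_eq_one] at this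
    exact this.symm

theorem mem_regularSubgroups (hc : IsMultiplier c) : affineGroup c ∈ regularSubgroups (C n) :=
  ⟨affineGroup_le_hol c, hc.isRegularSubgroup⟩

end IsMultiplier

theorem addEquiv_apply_eq (α : C n ≃+ C n) (x : C n) : α x = α 1 * x := by
  obtain ⟨k, -, rfl⟩ := exists_natCast_lt x
  have h := map_nsmul α k 1
  rw [nsmul_eq_mul, nsmul_eq_mul, mul_one] at h
  rw [h, mul_comm]

theorem isUnit_addEquiv_one (α : C n ≃+ C n) : IsUnit (α 1) := by
  refine IsUnit.of_mul_eq_one (α.symm 1) ?_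
  rw [← addEquiv_apply_eq, AddEquiv.apply_symm_apply]

theorem exists_affine_of_mem_hol {f : Perm (C n)} (hf : f ∈ hol (C n)) :
    ∃ a b, IsUnit a ∧ ∀ x, f x = a * x + b := by
  induction hf using Subgroup.closure_induction with
  | mem f hf =>
    rcases hf with ⟨g, rfl⟩ | ⟨α, rfl⟩
    · exact ⟨1, g, isUnit_one, fun x => by simp⟩
    · exact ⟨α 1, 0, isUnit_addEquiv_one α, fun x => by
        rw [add_zero, ← addEquiv_apply_eq]; rfl⟩
  | one => exact ⟨1, 0, isUnit_one, fun x => by simp⟩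
  | mul f g _ _ hf hg =>
    obtain ⟨a, b, ha, h⟩ := hf
    obtain ⟨a', b', ha', h'⟩ := hg
    exact ⟨a * a', a * b' + b, ha.mul ha', fun x => by rw [Perm.mul_apply, h', h]; ring⟩
  | inv f _ hf =>
    obtain ⟨a, b, ⟨u, rfl⟩, h⟩ := hf
    refine ⟨↑u⁻¹, -(↑u⁻¹ * b), Units.isUnit _, fun x => ?_⟩
    rw [Perm.inv_eq_iff_eq, h, mul_add, Units.mul_inv_cancel_left, mul_neg,
      Units.mul_inv_cancel_left, neg_add_cancel_right]

/-- Regularity singles out the element sending 0 to g; its linear part is c g. The product of the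
elements for g and h sends 0 to c h * g + h, and comparing linear parts gives the gamma equation. -/
theorem exists_isMultiplier_of_mem_regularSubgroups {N : Subgroup (Perm (C n))}
    (hN : N ∈ regularSubgroups (C n)) : ∃ c, IsMultiplier c ∧ N = affineGroup c := by
  obtain ⟨hle, hreg⟩ := hN
  have key : ∀ g : C n, ∃ a, IsUnit a ∧ ∃ f ∈ N, ∀ x, f x = a * x + g := by
    intro g
    obtain ⟨f, ⟨hf, hg⟩, -⟩ := hreg 0 g
    obtain ⟨a, b, ha, h⟩ := exists_affine_of_mem_hol (hle hf)
    rw [h, mul_zero, zero_add] at hg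
    exact ⟨a, ha, f, hf, fun x => by rw [h, hg]⟩
  choose c hu f hf hfx using key
  have huniq : ∀ f' ∈ N, f' = f (f' 0) := fun f' hf' =>
    (hreg 0 (f' 0)).unique ⟨hf', rfl⟩ ⟨hf _, by rw [hfx, mul_zero, zero_add]⟩
  have hc : IsMultiplier c := by
    refine ⟨hu, fun g h => ?_⟩
    have h1 := huniq _ (mul_mem (hf h) (hf g))
    have e0 : (f h * f g) 0 = c h * g + h := by
      rw [Perm.mul_apply, hfx, hfx, mul_zero, zero_add]
    rw [e0] at h1
    have h2 := congrArg (fun p : Perm (C n) => p 1) h1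
    simp only [Perm.mul_apply, hfx] at h2
    linear_combination -h2
  refine ⟨c, hc, ?_⟩
  ext f'
  rw [hc.mem_affineGroup]
  constructor
  · intro h
    refine ⟨f' 0, fun x => ?_⟩
    conv_lhs => rw [huniq f' h]
    rw [hfx]
  · rintro ⟨g, hg⟩
    have : f' = f g := by
      ext x
      rw [hg, hfx]
    rw [this]
    exact hf g

theorem two_mul_natCast_add_one_isUnit (k : ℕ) : IsUnit (2 * (k : C n) + 1) :=
  isUnit_two_mul_add_one _

/-! ### Conjugation, level sets and normalizers for a general multiplier. -/

namespace IsMultiplier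

variable {c c' : C n → C n}

theorem comp_mul (hc : IsMultiplier c) (s : C n) : IsMultiplier fun x => c (s * x) where
  isUnit x := hc.isUnit _
  map_circ g h := by
    rw [← hc.map_circ]
    congr 1
    ring

/-- Conjugating by the inverse of σ_s keeps the linear part of an affine map and divides its
translation part by s. -/
theorem conjK_affineGroup (hc : IsMultiplier c) (k : ℕ) :
    conjK (affineGroup c) k = affineGroup fun x => c ((2 * (k : C n) + 1) * x) := by
  have hs := two_mul_natCast_add_one_isUnit (n := n) k
  set s := 2 * (k : C n) + 1 with hsdef
  ext f
  rw [(hc.comp_mul s).mem_affineGroup, conjK, conjSubgroup, Subgroup.mem_map_equiv,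
    hc.mem_affineGroup]
  have e : ∀ x, (((MulAut.conj (sigma s).symm.toEquiv).symm f : Perm (C n))) (s * x) =
      s * f x := by
    intro x
    rw [MulAut.conj_symm_apply, Perm.mul_apply, Perm.mul_apply, ← sigma_apply hs x]
    have h1 : ((sigma s).symm.toEquiv : Perm (C n)) (sigma s x) = x :=
      (sigma s).symm_apply_apply x
    rw [h1, ← sigma_apply hs (f x)]
    rfl
  constructor
  · rintro ⟨g, hg⟩
    obtain ⟨g', rfl⟩ : ∃ g', s * g' = g := exists_mul_odd_eq _ _
    refine ⟨g', fun x => hs.mul_left_cancel ?_⟩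
    rw [← e, hg]
    ring
  · rintro ⟨g, hg⟩
    refine ⟨s * g, fun x => ?_⟩
    obtain ⟨x', rfl⟩ : ∃ g', s * g' = x := exists_mul_odd_eq _ _
    rw [e, hg]
    ring

theorem map_add_of_map_eq_one (hc : IsMultiplier c) {k : C n} (hk : c k = 1) (g : C n) :
    c (g + k) = c g := by
  have := hc.map_circ g k
  rwa [hk, one_mul, mul_one] at this

theorem map_natCast_mul_of_map_eq_one (hc : IsMultiplier c) {k : C n} (hk : c k = 1) (j : ℕ) :
    c (j * k) = 1 := by
  induction j with
  | zero => rw [Nat.cast_zero, zero_mul, hc.map_zero]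
  | succ j ih => rw [Nat.cast_succ, add_mul, one_mul, hc.map_add_of_map_eq_one hk, ih]

theorem map_mul_of_map_eq_one (hc : IsMultiplier c) {k : C n} (hk : c k = 1) (x : C n) :
    c (x * k) = 1 := by
  obtain ⟨j, -, rfl⟩ := exists_natCast_lt x
  exact hc.map_natCast_mul_of_map_eq_one hk j

/-- The level sets of c are the cosets of the points where c is 1. The gamma equation only shows
that (c h)⁻¹(g - h) is such a point, but these points are closed under all multiples. -/
theorem map_eq_iff (hc : IsMultiplier c) {g h : C n} : c g = c h ↔ c (g - h) = 1 := by
  constructor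
  · intro e
    obtain ⟨u, hu⟩ := hc.isUnit h
    have h1 := hc.map_circ (↑u⁻¹ * (g - h)) h
    rw [← hu, Units.mul_inv_cancel_left, sub_add_cancel, e, hu] at h1
    have h2 : c (↑u⁻¹ * (g - h)) = 1 := (hc.isUnit h).mul_right_cancel (by rw [← h1, one_mul])
    have h3 := hc.map_mul_of_map_eq_one h2 u
    rwa [Units.mul_inv_cancel_left] at h3
  · intro e
    have := hc.map_add_of_map_eq_one e h
    rwa [add_sub_cancel] at this

/-- Conjugating the element of parameter g by that of parameter h keeps the linear part c g and
changes the translation to some t. The result lies in the group iff c t = c g, that is, c (t - g) =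
1. -/
theorem le_normalizer_iff (hc : IsMultiplier c) (hc' : IsMultiplier c') :
    affineGroup c' ≤ Subgroup.normalizer (affineGroup c : Set (Perm (C n))) ↔
      ∀ g h, c ((c' h - 1) * g - (c g - 1) * h) = 1 := by
  have conj_apply : ∀ {f f' : Perm (C n)} {g h : C n}, (∀ x, f x = c g * x + g) →
      (∀ x, f' x = c' h * x + h) →
      ∀ y, (f' * f * f'⁻¹) y = c g * y + ((c' h - 1) * g - (c g - 1) * h + g) := by
    intro f f' g h hf hf' y
    obtain ⟨x, rfl⟩ := f'.surjective y
    rw [Perm.mul_apply, perm_inv_apply_self, Perm.mul_apply, hf, hf', hf']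
    ring
  constructor
  · intro hle g h
    obtain ⟨f, hf, hfx⟩ := hc.exists_mem_affineGroup g
    obtain ⟨f', hf', hfx'⟩ := hc'.exists_mem_affineGroup h
    have hmem := (Subgroup.mem_normalizer_iff.1 (hle hf') f).1 hf
    obtain ⟨t, ht⟩ := (hc.mem_affineGroup _).1 hmem
    have e := conj_apply hfx hfx'
    have h0 := (ht 0).symm.trans (e 0)
    have h1 := (ht 1).symm.trans (e 1)
    have ht0 : t = (c' h - 1) * g - (c g - 1) * h + g := by linear_combination h0
    have hct : c t = c g := by linear_combination h1 - h0
    rw [hc.map_eq_iff, ht0, add_sub_cancel_right] at hct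
    exact hct
  · intro H
    have key : ∀ f' ∈ affineGroup c', ∀ f ∈ affineGroup c, f' * f * f'⁻¹ ∈ affineGroup c := by
      intro f' hf' f hf
      obtain ⟨g, hg⟩ := (hc.mem_affineGroup _).1 hf
      obtain ⟨h, hh⟩ := (hc'.mem_affineGroup _).1 hf'
      refine (hc.mem_affineGroup _).2 ⟨(c' h - 1) * g - (c g - 1) * h + g, fun y => ?_⟩
      rw [conj_apply hg hh y, hc.map_eq_iff.2 ((congrArg c (add_sub_cancel_right _ g)).trans
        (H g h))]
    intro f' hf'
    refine Subgroup.mem_normalizer_iff.2 fun f => ⟨key f' hf' f, fun hf => ?_⟩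
    have := key f'⁻¹ (inv_mem hf') _ hf
    rwa [inv_inv, show f'⁻¹ * (f' * f * f'⁻¹) * f' = f by group] at this

end IsMultiplier

/-! ### Multipliers that are affine on each parity class. -/

/-- The function `x ↦ 1 + β x` on even `x` and `x ↦ 1 + ω + β x` on odd `x`. -/
def multiplier (ω β x : C n) : C n := 1 + β * x + ω * parity x

theorem multiplier_two_mul (hn : 1 ≤ n) (ω β y : C n) :
    multiplier ω β (2 * y) = 1 + β * (2 * y) := by
  rw [multiplier, parity_two_mul hn, mul_zero, add_zero]

theorem multiplier_two_mul_add_one (hn : 1 ≤ n) (ω β y : C n) :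
    multiplier ω β (2 * y + 1) = 1 + β * (2 * y + 1) + ω := by
  rw [multiplier, parity_two_mul_add_one hn, mul_one]

theorem eq_multiplier (hn : 1 ≤ n) {c : C n → C n} {ω β : C n}
    (h0 : ∀ y, c (2 * y) = 1 + β * (2 * y)) (h1 : ∀ y, c (2 * y + 1) = 1 + β * (2 * y + 1) + ω) :
    c = multiplier ω β := by
  funext x
  rcases even_or_odd x with ⟨y, rfl⟩ | ⟨y, rfl⟩
  · rw [h0, multiplier_two_mul hn]
  · rw [h1, multiplier_two_mul_add_one hn]

/-- The values at 2 and 1 determine the function. The pair (ω, β) is not unique: 2^(n-1) may be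
moved between ω and β. -/
theorem multiplier_eq_iff (hn : 1 ≤ n) {ω β ω' β' : C n} :
    multiplier ω β = multiplier ω' β' ↔ 2 * (β - β') = 0 ∧ β + ω = β' + ω' := by
  constructor
  · intro h
    have h1 := congrFun h (2 * 0 + 1)
    have h2 := congrFun h (2 * 1)
    rw [multiplier_two_mul hn, multiplier_two_mul hn] at h2
    rw [multiplier_two_mul_add_one hn, multiplier_two_mul_add_one hn] at h1
    exact ⟨by linear_combination h2, by linear_combination h1⟩
  · rintro ⟨h1, h2⟩
    refine eq_multiplier hn (fun y => ?_) fun y => ?_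
    · rw [multiplier_two_mul hn]
      linear_combination y * h1
    · rw [multiplier_two_mul_add_one hn]
      linear_combination y * h1 + h2

/-- The gamma equation at (g, h) = (1, 2) gives the first condition and at (1, 1) the second; these
two instances imply all others. -/
theorem isMultiplier_multiplier_iff (hn : 1 ≤ n) (w b : C n) :
    IsMultiplier (multiplier (2 * w) (2 * b)) ↔
      2 * (2 * b) * (2 * w) = 0 ∧ 2 * w * (2 * w + 2 * b + 2) = 0 := by
  constructor
  · intro h
    have h1 := h.map_circ (2 * 0 + 1) (2 * 1)
    have h2 := h.map_circ (2 * 0 + 1) (2 * 0 + 1)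
    simp only [multiplier_two_mul hn, multiplier_two_mul_add_one hn] at h1 h2
    rw [show (1 + 2 * b * (2 * 1)) * (2 * 0 + 1) + 2 * 1 = 2 * (2 * b + 1) + 1 by ring,
      multiplier_two_mul_add_one hn] at h1
    rw [show (1 + 2 * b * (2 * 0 + 1) + 2 * w) * (2 * 0 + 1) + (2 * 0 + 1) = 2 * (1 + b + w) by
      ring, multiplier_two_mul hn] at h2
    exact ⟨by linear_combination -h1, by linear_combination -h2⟩
  · rintro ⟨h1, h2⟩
    constructor
    · intro x
      rcases even_or_odd x with ⟨y, rfl⟩ | ⟨y, rfl⟩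
      · rw [multiplier_two_mul hn]
        convert isUnit_two_mul_add_one (b * (2 * y)) using 1
        ring
      · rw [multiplier_two_mul_add_one hn]
        convert isUnit_two_mul_add_one (b * (2 * y + 1) + w) using 1
        ring
    · intro g h
      rcases even_or_odd g with ⟨x, rfl⟩ | ⟨x, rfl⟩ <;>
        rcases even_or_odd h with ⟨y, rfl⟩ | ⟨y, rfl⟩ <;>
        simp only [multiplier_two_mul hn, multiplier_two_mul_add_one hn]
      · rw [show (1 + 2 * b * (2 * y)) * (2 * x) + 2 * y =
          2 * ((1 + 2 * b * (2 * y)) * x + y) by ring, multiplier_two_mul hn]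
        ring
      · rw [show (1 + 2 * b * (2 * y + 1) + 2 * w) * (2 * x) + (2 * y + 1) =
          2 * ((1 + 2 * b * (2 * y + 1) + 2 * w) * x + y) + 1 by ring,
          multiplier_two_mul_add_one hn]
        ring
      · rw [show (1 + 2 * b * (2 * y)) * (2 * x + 1) + 2 * y =
          2 * ((1 + 2 * b * (2 * y)) * x + 2 * b * y + y) + 1 by ring,
          multiplier_two_mul_add_one hn]
        linear_combination -y * h1
      · rw [show (1 + 2 * b * (2 * y + 1) + 2 * w) * (2 * x + 1) + (2 * y + 1) =
          2 * ((1 + 2 * b * (2 * y + 1) + 2 * w) * x + b * (2 * y + 1) + w + y + 1) by ring,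
          multiplier_two_mul hn]
        linear_combination -h2 - y * h1

/-- Even parameters `ω`, `β` for which `multiplier ω β` is a multiplier. -/
structure IsAdmissible (ω β : C n) : Prop where
  even_left : ∃ w, ω = 2 * w
  even_right : ∃ b, β = 2 * b
  two_mul_mul : 2 * β * ω = 0
  mul_add : ω * (ω + β + 2) = 0

/-- The group associated with `multiplier ω β`. -/
noncomputable def multiplierGroup (ω β : C n) : Subgroup (Perm (C n)) :=
  affineGroup (multiplier ω β)

namespace IsAdmissible

variable {ω β ω' β' : C n}

theorem isMultiplier (hn : 1 ≤ n) (h : IsAdmissible ω β) : IsMultiplier (multiplier ω β) := by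
  obtain ⟨⟨w, rfl⟩, ⟨b, rfl⟩, h1, h2⟩ := h
  exact (isMultiplier_multiplier_iff hn w b).2 ⟨h1, h2⟩

theorem multiplierGroup_eq_iff (hn : 1 ≤ n) (h : IsAdmissible ω β) (h' : IsAdmissible ω' β') :
    multiplierGroup ω β = multiplierGroup ω' β' ↔ 2 * (β - β') = 0 ∧ β + ω = β' + ω' := by
  rw [multiplierGroup, multiplierGroup, (h.isMultiplier hn).affineGroup_inj (h'.isMultiplier hn),
    multiplier_eq_iff hn]

/-- The argument t in the general criterion is always even, and on even t the multiplier is 1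
exactly when βt = 0. The pairs (1, 1) and (1, 2) already force both conditions. -/
theorem le_normalizer_iff (hn : 1 ≤ n) (h : IsAdmissible ω β) (h' : IsAdmissible ω' β') :
    multiplierGroup ω' β' ≤
        Subgroup.normalizer (multiplierGroup ω β : Set (Perm (C n))) ↔
      2 * β * ω' = 0 ∧ β * (β' + ω' - (β + ω)) = 0 := by
  rw [multiplierGroup, multiplierGroup,
    (h.isMultiplier hn).le_normalizer_iff (h'.isMultiplier hn)]
  obtain ⟨⟨w, rfl⟩, ⟨b, rfl⟩, h1, -⟩ := h
  obtain ⟨⟨w', rfl⟩, ⟨b', rfl⟩, -, -⟩ := h'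
  have key : ∀ {t} y, t = 2 * y →
      (multiplier (2 * w) (2 * b) t = 1 ↔ 2 * b * (2 * y) = 0) := by
    rintro _ y rfl
    rw [multiplier_two_mul hn, add_eq_left]
  constructor
  · intro H
    have h11 := H (2 * 0 + 1) (2 * 0 + 1)
    have h21 := H (2 * 1) (2 * 0 + 1)
    simp only [multiplier_two_mul hn, multiplier_two_mul_add_one hn] at h11 h21
    rw [key (b' + w' - (b + w)) (by ring)] at h11
    rw [key (2 * b' + 2 * w' - 2 * b) (by ring)] at h21
    have h12 := H (2 * 0 + 1) (2 * 1)
    simp only [multiplier_two_mul hn, multiplier_two_mul_add_one hn] at h12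
    rw [key (2 * b' - (2 * b + 2 * w)) (by ring)] at h12
    exact ⟨by linear_combination 2 * h11 - h12, by linear_combination h11⟩
  · rintro ⟨h2, h3⟩ g h
    rcases even_or_odd g with ⟨x, rfl⟩ | ⟨x, rfl⟩ <;>
      rcases even_or_odd h with ⟨y, rfl⟩ | ⟨y, rfl⟩ <;>
      simp only [multiplier_two_mul hn, multiplier_two_mul_add_one hn]
    · rw [key (4 * b' * x * y - 4 * b * x * y) (by ring)]
      linear_combination 4 * x * y * h3 - 2 * x * y * h2 + 2 * x * y * h1
    · rw [key (2 * (b' * (2 * y + 1) + w' - b * (2 * y + 1)) * x) (by ring)]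
      linear_combination 2 * x * (2 * y + 1) * h3 - 2 * x * y * h2 + x * (2 * y + 1) * h1
    · rw [key (2 * (b' * (2 * x + 1) - w - b * (2 * x + 1)) * y) (by ring)]
      linear_combination 2 * y * (2 * x + 1) * h3 - (2 * x + 1) * y * h2 + 2 * x * y * h1
    · rw [key ((b' - b) * (2 * x + 1) * (2 * y + 1) + w' * (2 * x + 1) - w * (2 * y + 1)) (by ring)]
      linear_combination (2 * x + 1) * (2 * y + 1) * h3 - (2 * x + 1) * y * h2 +
        (2 * y + 1) * x * h1

theorem mem_regularSubgroups (hn : 1 ≤ n) (h : IsAdmissible ω β) :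
    multiplierGroup ω β ∈ regularSubgroups (C n) :=
  (h.isMultiplier hn).mem_regularSubgroups

end IsAdmissible

/-! ### Geometric sums and cyclic groups. -/

section Orbit

open Finset

/-- If `a ≡ 1` modulo `4`, then the orbit of `0` under `x ↦ a x + 1` is everything. -/
theorem exists_geom_sum_eq (d y : C n) : ∃ k, ∑ i ∈ range k, (1 + 4 * d) ^ i = y := by
  have hpow : ∀ m : ℕ, ∃ e, (1 + 4 * d) ^ m = 1 + 4 * e := by
    intro m
    induction m with
    | zero => exact ⟨0, by ring⟩
    | succ m ih =>
      obtain ⟨e, he⟩ := ih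
      exact ⟨e + d + 4 * d * e, by rw [pow_succ, he]; ring⟩
  have hadd : ∀ k m : ℕ, ∑ i ∈ range (k + m), (1 + 4 * d) ^ i =
      ∑ i ∈ range k, (1 + 4 * d) ^ i + (1 + 4 * d) ^ k * ∑ i ∈ range m, (1 + 4 * d) ^ i := by
    intro k m
    rw [sum_range_add, mul_sum]
    simp only [pow_add]
  -- Doubling the block multiplies its sum by 1 + (1 + 4d)^(2^j), which is twice an odd element.
  have htwo : ∀ j : ℕ, ∃ e, ∑ i ∈ range (2 ^ j), (1 + 4 * d) ^ i = 2 ^ j * (2 * e + 1) := by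
    intro j
    induction j with
    | zero => exact ⟨0, by simp⟩
    | succ j ih =>
      obtain ⟨e, he⟩ := ih
      obtain ⟨f, hf⟩ := hpow (2 ^ j)
      refine ⟨e + f + 2 * e * f, ?_⟩
      rw [pow_succ, mul_two, hadd, he, hf]
      ring
  -- Successive 2-adic approximation: if the error is an odd multiple of 2^j, appending 2^j terms
  -- makes it a multiple of 2^(j+1).
  have main : ∀ j : ℕ, ∃ k t, ∑ i ∈ range k, (1 + 4 * d) ^ i = y + 2 ^ j * t := by
    intro j
    induction j with
    | zero => exact ⟨0, -y, by simp⟩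
    | succ j ih =>
      obtain ⟨k, t, h⟩ := ih
      rcases even_or_odd t with ⟨s, rfl⟩ | ⟨s, rfl⟩
      · exact ⟨k, s, by rw [h]; ring⟩
      · obtain ⟨e, he⟩ := htwo j
        obtain ⟨f, hf⟩ := hpow k
        refine ⟨k + 2 ^ j, s + 1 + e + 2 * f + 4 * f * e, ?_⟩
        rw [hadd, h, he, hf]
        ring
  obtain ⟨k, t, h⟩ := main n
  exact ⟨k, by rw [h, two_pow_self_eq_zero, zero_mul, add_zero]⟩

/-- Both sides satisfy the recursion c(c(1)x + 1) = c(x)c(1) and agree at 0, whose orbit under x ↦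
c(1)x + 1 is everything. -/
theorem IsMultiplier.eq_of_map_one {c : C n → C n} (hc : IsMultiplier c) {d : C n}
    (h1 : c 1 = 1 + 4 * d) (x : C n) : c x = 1 + 4 * d * x := by
  obtain ⟨k, rfl⟩ := exists_geom_sum_eq d x
  induction k with
  | zero => rw [sum_range_zero, hc.map_zero]; ring
  | succ k ih =>
    rw [geom_sum_succ]
    have := hc.map_circ (∑ i ∈ range k, (1 + 4 * d) ^ i) 1
    rw [h1, ih] at this
    rw [this]
    ring

/-- The powers of the element of parameter 1 send 0 to the geometric sums, so they are transitive
and by regularity exhaust the group. -/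
theorem isCyclic_affineGroup {c : C n → C n} (hc : IsMultiplier c) {d : C n}
    (h1 : c 1 = 1 + 4 * d) : IsCyclic (affineGroup c) := by
  obtain ⟨f, hf, hfx⟩ := hc.exists_mem_affineGroup 1
  have hpow : ∀ k : ℕ, (f ^ k) 0 = ∑ i ∈ range k, (1 + 4 * d) ^ i := by
    intro k
    induction k with
    | zero => simp
    | succ k ih => rw [pow_succ', Perm.mul_apply, hfx, ih, geom_sum_succ, h1]
  refine ⟨⟨f, hf⟩, fun ⟨g, hg⟩ => ?_⟩
  obtain ⟨k, hk⟩ := exists_geom_sum_eq d (g 0)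
  refine ⟨k, Subtype.ext ?_⟩
  refine (hc.isRegularSubgroup 0 (g 0)).unique ⟨?_, ?_⟩ ⟨hg, rfl⟩
  · exact SetLike.coe_mem _
  · change ((⟨f, hf⟩ ^ (k : ℤ) : affineGroup c) : Perm (C n)) 0 = g 0
    rw [zpow_natCast, SubmonoidClass.coe_pow, hpow, hk]

end Orbit

/-! ### Admissible parameters and the classification of multipliers. -/

theorem isAdmissible_zero_two_mul (t : C n) : IsAdmissible 0 (2 * t) :=
  ⟨⟨0, by ring⟩, ⟨t, rfl⟩, by ring, by ring⟩

theorem isAdmissible_quarter_two_mul_odd (hn : 4 ≤ n) (t : C n) :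
    IsAdmissible (4 * quarterStep n) (2 * (2 * t + 1)) := by
  have h := sixteen_mul_quarterStep hn
  obtain ⟨r, hr⟩ : ∃ r, r = quarterStep n := ⟨_, rfl⟩
  rw [← hr] at h ⊢
  refine ⟨⟨2 * r, by ring⟩, ⟨2 * t + 1, by ring⟩, ?_, ?_⟩
  · linear_combination (2 * t + 1) * h
  · linear_combination (r + t + 1) * h

theorem isAdmissible_exceptional (hn : 4 ≤ n) (i j : C n) :
    IsAdmissible (8 * quarterStep n * j - 2 - 4 * quarterStep n * i) (4 * quarterStep n * i) := by
  have h := sixteen_mul_quarterStep hn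
  obtain ⟨r, hr⟩ : ∃ r, r = quarterStep n := ⟨_, rfl⟩
  rw [← hr] at h ⊢
  refine ⟨⟨4 * r * j - 1 - 2 * r * i, by ring⟩, ⟨2 * r * i, by ring⟩, ?_, ?_⟩
  · linear_combination (i * (4 * r * j - 1 - 2 * r * i)) * h
  · linear_combination (j * (4 * r * j - 1 - 2 * r * i)) * h

/-- The group with multiplier `1 + 2 ^ (n - 2) i x` on even `x` and
`2 ^ (n - 1) j - 1 + 2 ^ (n - 2) i (x - 1)` on odd `x`. -/
noncomputable def exceptionalGroup (n : ℕ) (i j : C n) : Subgroup (Perm (C n)) :=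
  multiplierGroup (8 * quarterStep n * j - 2 - 4 * quarterStep n * i) (4 * quarterStep n * i)

theorem IsMultiplier.classification (hn : 4 ≤ n) {c : C n → C n} (hc : IsMultiplier c) :
    (∃ t, c = multiplier 0 (4 * t)) ∨ (∃ t, c = multiplier 0 (2 * (2 * t + 1))) ∨
      (∃ t, c = multiplier (4 * quarterStep n) (2 * (2 * t + 1))) ∨
      ∃ i j : C n, (i = 0 ∨ i = 1) ∧ (j = 0 ∨ j = 1) ∧
        c = multiplier (8 * quarterStep n * j - 2 - 4 * quarterStep n * i)
          (4 * quarterStep n * i) := by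
  have hn1 : 1 ≤ n := by omega
  have hq := sixteen_mul_quarterStep hn
  have h2ne : (2 : C n) ≠ 0 := fun h => eight_ne_zero hn (by linear_combination 4 * h)
  obtain ⟨r, hr⟩ : ∃ r, r = quarterStep n := ⟨_, rfl⟩
  have hzero := fun x h => eq_zero_or_eq_of_two_mul_eq_zero hn (x := x) h
  have hfour := fun x h => exists_of_four_mul_eq_zero hn (x := x) h
  rw [← hr] at hq hzero hfour ⊢
  obtain ⟨a, ha⟩ := exists_odd_of_isUnit hn1 (hc.isUnit 1)
  rcases even_or_odd a with ⟨t, rfl⟩ | ⟨s, rfl⟩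
  · refine .inl ⟨t, ?_⟩
    funext x
    rw [hc.eq_of_map_one (d := t) (by rw [ha]; ring), multiplier, zero_mul, add_zero]
  right
  obtain ⟨b, hb⟩ := exists_odd_of_isUnit hn1 (hc.isUnit 2)
  rcases even_or_odd b with ⟨p, rfl⟩ | ⟨p, rfl⟩
  swap
  · exfalso
    -- `c 1 ≡ c 2 ≡ 3` modulo `4` forces `c 2 = 1`
    have e1 := hc.map_circ 2 1
    have e2 := hc.map_circ 1 2
    have e3 : c (c 1 * 2 + 1) = c (c 2 * 1 + 2) := by rw [e1, e2, mul_comm]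
    rw [hc.map_eq_iff, ha, hb] at e3
    -- The argument of c in `e3` equals 2(2(2s - p) + 1), twice a unit, so 2 is one of its
    -- multiples.
    obtain ⟨y, hy⟩ := exists_mul_odd_eq (2 * s - p) (1 : C n)
    have e4 := hc.map_mul_of_map_eq_one e3 y
    rw [show y * ((2 * (2 * s + 1) + 1) * 2 + 1 - ((2 * (2 * p + 1) + 1) * 1 + 2)) = 2 by
      linear_combination 2 * hy, hb] at e4
    exact h2ne (eq_zero_of_mul_odd p (by linear_combination e4))
  have heven : ∀ y, c (2 * y) = 1 + 4 * p * y := fun y =>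
    (hc.comp_mul 2).eq_of_map_one (d := p) (by simp only [mul_one]; rw [hb]; ring) y
  have hodd : ∀ y, c (2 * y + 1) = c 1 + 4 * p * y := by
    intro y
    obtain ⟨z, rfl⟩ : ∃ z, c 1 * z = y := by rw [ha]; exact exists_mul_odd_eq _ _
    have := hc.map_circ (2 * z) 1
    rw [heven, show c 1 * (2 * z) + 1 = 2 * (c 1 * z) + 1 by ring] at this
    rw [this]
    ring
  -- The slope 2p is read off from the even points, and ω is then forced by c 1 = 1 + β + ω.
  have hcm : c = multiplier (2 * (2 * s + 1 - p)) (2 * p) := by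
    refine eq_multiplier hn1 (fun y => ?_) fun y => ?_
    · rw [heven]; ring
    · rw [hodd, ha]; ring
  have hadm := hc
  rw [hcm, isMultiplier_multiplier_iff hn1] at hadm
  obtain ⟨h1, h2⟩ := hadm
  rw [hcm]
  simp only [multiplier_eq_iff hn1]
  rcases even_or_odd p with ⟨v, rfl⟩ | ⟨v, rfl⟩
  -- For p even, ω is twice an odd element. Cancelling that factor leaves 4β = 0 and 2(β + ω + 2) =
  -- 0, the exceptional groups.
  · right; right
    have hv : 4 * (4 * v) = 0 := eq_zero_of_mul_odd (s - v) (by linear_combination h1)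
    obtain ⟨i, hi⟩ := hfour _ hv
    have hs : 2 * (4 * s + 4) = 0 := eq_zero_of_mul_odd (s - v) (by linear_combination h2)
    have hj : ∃ j : C n, (j = 0 ∨ j = 1) ∧ 4 * s + 4 = 8 * r * j := by
      rcases hzero _ hs with h | h
      · exact ⟨0, .inl rfl, by rw [h, mul_zero]⟩
      · exact ⟨1, .inr rfl, by rw [h, mul_one]⟩
    obtain ⟨j, hj01, hj⟩ := hj
    have hi' : ∃ i' z : C n, (i' = 0 ∨ i' = 1) ∧ i = 2 * z + i' := by
      rcases even_or_odd i with ⟨z, rfl⟩ | ⟨z, rfl⟩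
      · exact ⟨0, z, .inl rfl, by ring⟩
      · exact ⟨1, z, .inr rfl, rfl⟩
    obtain ⟨i', z, hi01, rfl⟩ := hi'
    refine ⟨i', j, hi01, hj01, ?_, ?_⟩
    · linear_combination 2 * hi + z * hq
    · linear_combination hj
  -- For p odd, β is twice an odd element, so ω = 4qy. The even part of y contributes a multiple of
  -- 8q, which is absorbed into β; the parity of y decides between P and M.
  · have hs : 4 * (4 * (s - v)) = 0 := eq_zero_of_mul_odd v (by linear_combination h1)
    obtain ⟨y, hy⟩ := hfour _ hs
    rcases even_or_odd y with ⟨z, rfl⟩ | ⟨z, rfl⟩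
    · refine .inl ⟨v + 2 * r * z, ?_, ?_⟩
      · linear_combination -z * hq
      · linear_combination hy
    · refine .inr (.inl ⟨v + 2 * r * z, ?_, ?_⟩)
      · linear_combination -z * hq
      · linear_combination hy

theorem mem_regularSubgroups_iff (hn : 4 ≤ n) (N : Subgroup (Perm (C n))) :
    N ∈ regularSubgroups (C n) ↔ (∃ t, N = multiplierGroup 0 (4 * t)) ∨
      (∃ t, N = multiplierGroup 0 (2 * (2 * t + 1))) ∨
      (∃ t, N = multiplierGroup (4 * quarterStep n) (2 * (2 * t + 1))) ∨
      ∃ i j : C n, (i = 0 ∨ i = 1) ∧ (j = 0 ∨ j = 1) ∧ N = exceptionalGroup n i j := by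
  have hn1 : 1 ≤ n := by omega
  constructor
  · intro hN
    obtain ⟨c, hc, rfl⟩ := exists_isMultiplier_of_mem_regularSubgroups hN
    rcases hc.classification hn with ⟨t, rfl⟩ | ⟨t, rfl⟩ | ⟨t, rfl⟩ | ⟨i, j, hi, hj, rfl⟩
    · exact .inl ⟨t, rfl⟩
    · exact .inr (.inl ⟨t, rfl⟩)
    · exact .inr (.inr (.inl ⟨t, rfl⟩))
    · exact .inr (.inr (.inr ⟨i, j, hi, hj, rfl⟩))
  · rintro (⟨t, rfl⟩ | ⟨t, rfl⟩ | ⟨t, rfl⟩ | ⟨i, j, -, -, rfl⟩)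
    · rw [show 4 * t = 2 * (2 * t) by ring]
      exact (isAdmissible_zero_two_mul _).mem_regularSubgroups hn1
    · exact (isAdmissible_zero_two_mul _).mem_regularSubgroups hn1
    · exact (isAdmissible_quarter_two_mul_odd hn _).mem_regularSubgroups hn1
    · exact (isAdmissible_exceptional hn _ _).mem_regularSubgroups hn1

/-! ### Parameters of the named gamma functions and groups. -/

theorem gamma1_eq : gamma1 n = fun x => sigma (multiplier 0 0 x) := by
  funext x
  rw [multiplier, gamma1]
  congr 1
  ring

theorem gamma2_eq (hn : 4 ≤ n) :
    gamma2 n = fun x => sigma (multiplier 0 (8 * quarterStep n) x) := by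
  have hq := sixteen_mul_quarterStep hn
  have key : ∀ k : ℕ, (8 * quarterStep n + 1) ^ k = 1 + 8 * quarterStep n * k := by
    intro k
    induction k with
    | zero => simp
    | succ k ih =>
      rw [pow_succ, ih]
      push_cast
      linear_combination 4 * quarterStep n * k * hq
  funext x
  rw [multiplier, gamma2, two_pow_sub_one hn, key, ZMod.natCast_zmod_val, zero_mul, add_zero]

theorem pow_val_eq_multiplier (hn : 1 ≤ n) {a : C n} (ha : a * a = 1) (x : C n) :
    a ^ x.val = multiplier (a - 1) 0 x := by
  rcases even_or_odd x with ⟨y, rfl⟩ | ⟨y, rfl⟩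
  · obtain ⟨j, hj⟩ : ∃ j, (2 * y).val = 2 * j :=
      ⟨(2 * y).val / 2, by have := val_mod_two_two_mul hn y; omega⟩
    rw [multiplier_two_mul hn, hj, pow_mul, sq, ha]
    ring
  · obtain ⟨j, hj⟩ : ∃ j, (2 * y + 1).val = 2 * j + 1 :=
      ⟨(2 * y + 1).val / 2, by have := val_mod_two_two_mul_add_one hn y; omega⟩
    rw [multiplier_two_mul_add_one hn, hj, pow_succ, pow_mul, sq, ha]
    ring

theorem gamma3_eq (hn : 4 ≤ n) :
    gamma3 n = fun x => sigma (multiplier (8 * quarterStep n - 2) 0 x) := by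
  have hq := sixteen_mul_quarterStep hn
  funext x
  rw [gamma3, two_pow_sub_one hn, pow_val_eq_multiplier (by omega)
    (by linear_combination (4 * quarterStep n - 1) * hq)]
  congr 2
  ring

theorem gamma4_eq (hn : 4 ≤ n) : gamma4 n = fun x => sigma (multiplier (-2) 0 x) := by
  funext x
  rw [gamma4, two_pow_self_eq_zero, pow_val_eq_multiplier (by omega) (by ring)]
  congr 2
  ring

theorem eq_natCast_of_val_mod_four (x : C n) {s : ℕ} (hs : x.val % 4 = s) :
    ∃ j : C n, x = 4 * j + s := by
  refine ⟨(x.val / 4 : ℕ), ?_⟩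
  conv_lhs => rw [← ZMod.natCast_zmod_val x, ← Nat.div_add_mod x.val 4, hs]
  push_cast
  ring

/-- With β = 2^(n-2) the product βx depends only on x modulo 4; this matches the case tables of
`gamma5` and `gamma6`. -/
theorem multiplier_of_val_mod_four (hn : 4 ≤ n) (ω x : C n) :
    multiplier ω (4 * quarterStep n) x =
      if x.val % 4 = 0 then 1 else if x.val % 4 = 1 then 1 + 4 * quarterStep n + ω
      else if x.val % 4 = 2 then 1 + 8 * quarterStep n else 1 + 12 * quarterStep n + ω := by
  have hq := sixteen_mul_quarterStep hn
  have hn1 : 1 ≤ n := by omega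
  have h4 : x.val % 4 < 4 := Nat.mod_lt _ (by decide)
  obtain ⟨s, hs⟩ : ∃ s, x.val % 4 = s := ⟨_, rfl⟩
  obtain ⟨j, hj⟩ := eq_natCast_of_val_mod_four x hs
  rw [hs] at h4 ⊢
  clear hs
  subst hj
  interval_cases s
  · rw [if_pos rfl, show 4 * j + ((0 : ℕ) : C n) = 2 * (2 * j) by push_cast; ring,
      multiplier_two_mul hn1]
    linear_combination j * hq
  · rw [if_neg (by decide), if_pos rfl,
      show 4 * j + ((1 : ℕ) : C n) = 2 * (2 * j) + 1 by push_cast; ring,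
      multiplier_two_mul_add_one hn1]
    linear_combination j * hq
  · rw [if_neg (by decide), if_neg (by decide), if_pos rfl,
      show 4 * j + ((2 : ℕ) : C n) = 2 * (2 * j + 1) by push_cast; ring,
      multiplier_two_mul hn1]
    linear_combination j * hq
  · rw [if_neg (by decide), if_neg (by decide), if_neg (by decide),
      show 4 * j + ((3 : ℕ) : C n) = 2 * (2 * j + 1) + 1 by push_cast; ring,
      multiplier_two_mul_add_one hn1]
    linear_combination j * hq

theorem gamma5_eq (hn : 4 ≤ n) :
    gamma5 n = fun x =>
      sigma (multiplier (4 * quarterStep n - 2) (4 * quarterStep n) x) := by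
  have hq := sixteen_mul_quarterStep hn
  funext x
  rw [multiplier_of_val_mod_four hn, gamma5]
  have h4 : x.val % 4 < 4 := Nat.mod_lt _ (by decide)
  generalize x.val % 4 = s at h4 ⊢
  interval_cases s <;> simp only [two_pow_sub_one hn, two_pow_self_eq_zero] <;> norm_num <;>
    congr 1
  · ring
  · ring
  · linear_combination -hq

theorem gamma6_eq (hn : 4 ≤ n) :
    gamma6 n = fun x =>
      sigma (multiplier (-2 - 4 * quarterStep n) (4 * quarterStep n) x) := by
  funext x
  rw [multiplier_of_val_mod_four hn, gamma6]
  have h4 : x.val % 4 < 4 := Nat.mod_lt _ (by decide)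
  generalize x.val % 4 = s at h4 ⊢
  interval_cases s <;> simp only [two_pow_sub_one hn, two_pow_self_eq_zero] <;> norm_num <;>
    congr 1
  · ring
  · ring

theorem gammaP_eq : gammaP n = fun x => sigma (multiplier 0 2 x) := by
  funext x
  rw [multiplier, gammaP]
  congr 1
  ring

theorem gammaC_eq (u : ℕ) : gammaC n u = fun x => sigma (multiplier 0 (2 ^ u) x) := by
  funext x
  rw [multiplier, gammaC]
  congr 1
  ring

theorem gammaM_eq (hn : 4 ≤ n) :
    gammaM n = fun x => sigma (multiplier (4 * quarterStep n) 2 x) := by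
  funext x
  rw [multiplier, gammaM, parity, two_pow_sub_two hn]
  split_ifs
  · congr 1
    ring
  · congr 1
    ring

theorem isAdmissible_zero_zero : IsAdmissible (0 : C n) 0 :=
  ⟨⟨0, by ring⟩, ⟨0, by ring⟩, by ring, by ring⟩

theorem exceptionalGroup_zero_zero : exceptionalGroup n 0 0 = multiplierGroup (-2) 0 := by
  rw [exceptionalGroup]; congr 1 <;> ring

theorem N1_eq : N1 n = multiplierGroup 0 0 := by
  rw [N1, gamma1_eq]; rfl

theorem N2_eq (hn : 4 ≤ n) : N2 n = multiplierGroup 0 (8 * quarterStep n) := by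
  rw [N2, gamma2_eq hn]; rfl

theorem N3_eq (hn : 4 ≤ n) : N3 n = exceptionalGroup n 0 1 := by
  rw [N3, gamma3_eq hn, exceptionalGroup, show 8 * quarterStep n * 1 - 2 - 4 * quarterStep n * 0 =
    8 * quarterStep n - 2 by ring, mul_zero]
  rfl

theorem N4_eq (hn : 4 ≤ n) : N4 n = exceptionalGroup n 0 0 := by
  rw [N4, gamma4_eq hn, exceptionalGroup_zero_zero]; rfl

theorem N5_eq (hn : 4 ≤ n) : N5 n = exceptionalGroup n 1 1 := by
  rw [N5, gamma5_eq hn, exceptionalGroup, show 8 * quarterStep n * 1 - 2 - 4 * quarterStep n * 1 =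
    4 * quarterStep n - 2 by ring, mul_one]
  rfl

theorem N6_eq (hn : 4 ≤ n) : N6 n = exceptionalGroup n 1 0 := by
  rw [N6, gamma6_eq hn, exceptionalGroup, show 8 * quarterStep n * 0 - 2 - 4 * quarterStep n * 1 =
    -2 - 4 * quarterStep n by ring, mul_one]
  rfl

/-- Scaling the argument by an odd number preserves its parity, so ω is unchanged. -/
theorem conjK_multiplierGroup (hn : 1 ≤ n) {ω β : C n} (h : IsAdmissible ω β) (k : ℕ) :
    conjK (multiplierGroup ω β) k = multiplierGroup ω (β * (2 * k + 1)) := by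
  rw [multiplierGroup, (h.isMultiplier hn).conjK_affineGroup, multiplierGroup]
  congr 1
  refine eq_multiplier hn (fun y => ?_) fun y => ?_
  · rw [show (2 * (k : C n) + 1) * (2 * y) = 2 * ((2 * k + 1) * y) by ring, multiplier_two_mul hn]
    ring
  · rw [show (2 * (k : C n) + 1) * (2 * y + 1) = 2 * ((2 * k + 1) * y + k) + 1 by ring,
      multiplier_two_mul_add_one hn]
    ring

theorem isAdmissible_zero_two : IsAdmissible (0 : C n) 2 := by
  simpa using isAdmissible_zero_two_mul (1 : C n)

theorem isAdmissible_quarter_two (hn : 4 ≤ n) : IsAdmissible (4 * quarterStep n) 2 := by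
  simpa using isAdmissible_quarter_two_mul_odd hn 0

theorem isAdmissible_zero_two_pow {u : ℕ} (hu : 2 ≤ u) (x : C n) :
    IsAdmissible (0 : C n) (2 ^ u * x) := by
  rw [show 2 ^ u * x = 2 * (2 ^ (u - 1) * x) by
    rw [← mul_assoc, ← pow_succ', Nat.sub_add_cancel (by omega)]]
  exact isAdmissible_zero_two_mul _

theorem NP_eq (hn : 4 ≤ n) (k : ℕ) : NP n k = multiplierGroup 0 (2 * (2 * (k : C n) + 1)) := by
  rw [NP, gammaP_eq]
  exact conjK_multiplierGroup (by omega) isAdmissible_zero_two k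

theorem NM_eq (hn : 4 ≤ n) (k : ℕ) :
    NM n k = multiplierGroup (4 * quarterStep n) (2 * (2 * (k : C n) + 1)) := by
  rw [NM, gammaM_eq hn]
  exact conjK_multiplierGroup (by omega) (isAdmissible_quarter_two hn) k

theorem NC_eq (hn : 1 ≤ n) {u : ℕ} (hu : 2 ≤ u) (k : ℕ) :
    NC n u k = multiplierGroup 0 (2 ^ u * (2 * (k : C n) + 1)) := by
  rw [NC, gammaC_eq]
  exact conjK_multiplierGroup hn (by simpa using isAdmissible_zero_two_pow hu (1 : C n)) k

/-! ### The list of vertices and its coincidences. -/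

theorem exists_natCast_lt_two_pow_mul_eq {j : ℕ} (hj : 1 ≤ j) (t : C n) :
    ∃ k : ℕ, k < 2 ^ (n - 1) ∧ 2 ^ j * t = 2 ^ j * (k : C n) := by
  obtain ⟨m, -, rfl⟩ := exists_natCast_lt t
  refine ⟨m % 2 ^ (n - 1), Nat.mod_lt _ (by positivity), ?_⟩
  rw [two_pow_mul_natCast_eq_iff]
  exact ((Nat.mod_modEq m (2 ^ (n - 1))).of_dvd (pow_dvd_pow 2 (by omega))).symm

theorem exists_two_pow_mul_odd_eq {w : ℕ} (hw : w ≤ n) (y : C n) :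
    ∃ u k : ℕ, w ≤ u ∧ u ≤ n ∧ k < 2 ^ (n - 1) ∧ 2 ^ w * y = 2 ^ u * (2 * (k : C n) + 1) := by
  -- Zero is represented with the exponent u = n.
  by_cases h0 : 2 ^ w * y = 0
  · exact ⟨n, 0, hw, le_rfl, by positivity, by rw [h0, two_pow_self_eq_zero, zero_mul]⟩
  obtain ⟨m, -, rfl⟩ := exists_natCast_lt y
  have hm : m ≠ 0 := by
    rintro rfl
    exact h0 (by simp)
  obtain ⟨e, s, ⟨l, rfl⟩, rfl⟩ := Nat.exists_eq_two_pow_mul_odd hm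
  obtain ⟨k, hk, hkl⟩ := exists_natCast_lt_two_pow_mul_eq (j := w + e + 1) (by omega) (l : C n)
  refine ⟨w + e, k, by omega, ?_, hk, ?_⟩
  · by_contra h
    obtain ⟨i, hi⟩ := Nat.exists_eq_add_of_le (show n ≤ w + e by omega)
    refine h0 ?_
    push_cast
    rw [← mul_assoc, ← pow_add, hi, pow_add, two_pow_self_eq_zero]
    ring
  · push_cast
    rw [pow_succ] at hkl
    rw [pow_add] at hkl ⊢
    linear_combination hkl

theorem mem_familyP_iff (hn : 4 ≤ n) (N : Subgroup (Perm (C n))) :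
    N ∈ familyP n ↔ ∃ t, N = multiplierGroup 0 (2 * (2 * t + 1)) := by
  constructor
  · rintro ⟨k, -, rfl⟩
    exact ⟨k, NP_eq hn k⟩
  · rintro ⟨t, rfl⟩
    obtain ⟨k, hk, h⟩ := exists_natCast_lt_two_pow_mul_eq (j := 2) (by omega) t
    refine ⟨k, hk, ?_⟩
    rw [NP_eq hn]
    congr 1
    linear_combination h

theorem mem_familyM_iff (hn : 4 ≤ n) (N : Subgroup (Perm (C n))) :
    N ∈ familyM n ↔ ∃ t, N = multiplierGroup (4 * quarterStep n) (2 * (2 * t + 1)) := by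
  constructor
  · rintro ⟨k, -, rfl⟩
    exact ⟨k, NM_eq hn k⟩
  · rintro ⟨t, rfl⟩
    obtain ⟨k, hk, h⟩ := exists_natCast_lt_two_pow_mul_eq (j := 2) (by omega) t
    refine ⟨k, hk, ?_⟩
    rw [NM_eq hn]
    congr 1
    linear_combination h

theorem exists_NC_iff (hn : 1 ≤ n) {w : ℕ} (hw2 : 2 ≤ w) (hw : w ≤ n)
    (N : Subgroup (Perm (C n))) :
    (∃ u k, w ≤ u ∧ u ≤ n ∧ k < 2 ^ (n - 1) ∧ N = NC n u k) ↔
      ∃ t, N = multiplierGroup 0 (2 ^ w * t) := by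
  constructor
  · rintro ⟨u, k, hu, -, -, rfl⟩
    refine ⟨2 ^ (u - w) * (2 * k + 1), ?_⟩
    rw [NC_eq hn (hw2.trans hu), ← mul_assoc, ← pow_add, Nat.add_sub_cancel' hu]
  · rintro ⟨t, rfl⟩
    obtain ⟨u, k, hu, hun, hk, h⟩ := exists_two_pow_mul_odd_eq hw t
    exact ⟨u, k, hu, hun, hk, by rw [h, NC_eq hn (hw2.trans hu)]⟩

theorem mem_familyC_iff (hn : 4 ≤ n) (N : Subgroup (Perm (C n))) :
    N ∈ familyC n ↔ ∃ t, N = multiplierGroup 0 (4 * t) := by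
  have h := exists_NC_iff (by omega) le_rfl (by omega : 2 ≤ n) N
  rw [show (2 : C n) ^ 2 = 4 by norm_num] at h
  rw [← h]
  simp only [familyC, Set.mem_ofPred_eq]

theorem regularSubgroups_eq (hn : 4 ≤ n) :
    regularSubgroups (C n) =
      {N1 n, N2 n, N3 n, N4 n, N5 n, N6 n} ∪ familyP n ∪ familyM n ∪ familyC n := by
  ext N
  rw [mem_regularSubgroups_iff hn, ← mem_familyC_iff hn, ← mem_familyP_iff hn,
    ← mem_familyM_iff hn]
  simp only [Set.mem_union, Set.mem_insert_iff, Set.mem_singleton_iff, N3_eq hn, N4_eq hn,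
    N5_eq hn, N6_eq hn]
  have h1 : N = N1 n → N ∈ familyC n := fun h =>
    (mem_familyC_iff hn N).2 ⟨0, by rw [h, N1_eq, mul_zero]⟩
  have h2 : N = N2 n → N ∈ familyC n := fun h =>
    (mem_familyC_iff hn N).2 ⟨2 * quarterStep n, by rw [h, N2_eq hn]; congr 1; ring⟩
  constructor
  · rintro (h | h | h | ⟨i, j, rfl | rfl, rfl | rfl, rfl⟩) <;> simp [*]
  · rintro ((((h | h | h | h | h | h) | h) | h) | h)
    · exact .inl (h1 h)
    · exact .inl (h2 h)
    · exact .inr (.inr (.inr ⟨0, 1, .inl rfl, .inr rfl, h⟩))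
    · exact .inr (.inr (.inr ⟨0, 0, .inl rfl, .inl rfl, h⟩))
    · exact .inr (.inr (.inr ⟨1, 1, .inr rfl, .inr rfl, h⟩))
    · exact .inr (.inr (.inr ⟨1, 0, .inr rfl, .inl rfl, h⟩))
    · exact .inr (.inl h)
    · exact .inr (.inr (.inl h))
    · exact .inl h

theorem two_mul_odd_ne_zero (hn : 4 ≤ n) (t : C n) : 2 * (2 * t + 1) ≠ 0 := fun h =>
  eight_ne_zero hn (by linear_combination 4 * eq_zero_of_mul_odd t h)

theorem eight_mul_odd_ne_zero (hn : 4 ≤ n) (t : C n) : 8 * (2 * t + 1) ≠ 0 := fun h =>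
  eight_ne_zero hn (eq_zero_of_mul_odd t h)

theorem NP_eq_NP_iff (hn : 4 ≤ n) (k h : ℕ) : NP n k = NP n h ↔ k ≡ h [MOD 2 ^ (n - 2)] := by
  rw [NP_eq hn, NP_eq hn, (isAdmissible_zero_two_mul _).multiplierGroup_eq_iff (by omega)
    (isAdmissible_zero_two_mul _), ← two_pow_mul_natCast_eq_iff]
  constructor
  · rintro ⟨-, h⟩
    linear_combination h
  · intro h
    exact ⟨by linear_combination 2 * h, by linear_combination h⟩

theorem NM_eq_NM_iff (hn : 4 ≤ n) (k h : ℕ) : NM n k = NM n h ↔ k ≡ h [MOD 2 ^ (n - 2)] := by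
  rw [NM_eq hn, NM_eq hn, (isAdmissible_quarter_two_mul_odd hn _).multiplierGroup_eq_iff (by omega)
    (isAdmissible_quarter_two_mul_odd hn _), ← two_pow_mul_natCast_eq_iff]
  constructor
  · rintro ⟨-, h⟩
    linear_combination h
  · intro h
    exact ⟨by linear_combination 2 * h, by linear_combination h⟩

theorem multiplierGroup_zero_left_inj (hn : 1 ≤ n) {u v : ℕ} (hu : 2 ≤ u) (hv : 2 ≤ v)
    (x y : C n) : multiplierGroup 0 (2 ^ u * x) = multiplierGroup 0 (2 ^ v * y) ↔
      2 ^ u * x = 2 ^ v * y := by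
  rw [(isAdmissible_zero_two_pow hu _).multiplierGroup_eq_iff hn (isAdmissible_zero_two_pow hv _)]
  constructor
  · rintro ⟨-, h⟩
    linear_combination h
  · intro h
    exact ⟨by linear_combination 2 * h, by linear_combination h⟩

theorem two_pow_mul_odd_ne_of_lt {u v : ℕ} (huv : u < v) (hu : u < n) (x y : C n) :
    2 ^ u * (2 * x + 1) ≠ 2 ^ v * y := by
  intro h
  obtain ⟨i, rfl⟩ := Nat.exists_eq_add_of_lt huv
  refine two_pow_ne_zero hu (eq_zero_of_mul_odd (x - 2 ^ i * y) ?_)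
  rw [pow_succ, pow_add] at h
  linear_combination h

/-- The exponent u is the 2-adic valuation of β. For u = n the truncated subtraction makes the
modulus 1, so the congruence is automatic. -/
theorem NC_eq_NC_iff (hn : 4 ≤ n) {u v : ℕ} (k h : ℕ) (hu : 2 ≤ u) (hun : u ≤ n) (hv : 2 ≤ v)
    (hvn : v ≤ n) : NC n u k = NC n v h ↔ u = v ∧ k ≡ h [MOD 2 ^ (n - u - 1)] := by
  rw [NC_eq (by omega) hu, NC_eq (by omega) hv, multiplierGroup_zero_left_inj (by omega) hu hv,
    Nat.sub_sub, ← two_pow_mul_natCast_eq_iff, pow_succ]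
  constructor
  · intro e
    obtain rfl : u = v := by
      rcases lt_trichotomy u v with huv | huv | huv
      · exact (two_pow_mul_odd_ne_of_lt huv (by omega) _ _ e).elim
      · exact huv
      · exact (two_pow_mul_odd_ne_of_lt huv (by omega) _ _ e.symm).elim
    exact ⟨rfl, by linear_combination e⟩
  · rintro ⟨rfl, e⟩
    linear_combination e

theorem NC_top (hn : 4 ≤ n) (k : ℕ) : NC n n k = N1 n := by
  rw [NC_eq (by omega) (by omega), two_pow_self_eq_zero, zero_mul, N1_eq]

theorem NC_pred (hn : 4 ≤ n) (k : ℕ) : NC n (n - 1) k = N2 n := by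
  rw [NC_eq (by omega) (by omega), two_pow_sub_one hn, N2_eq hn]
  congr 1
  linear_combination k * sixteen_mul_quarterStep hn

theorem isCyclic_NC (hn : 4 ≤ n) {u : ℕ} (hu : 2 ≤ u) (k : ℕ) : IsCyclic (NC n u k) := by
  rw [NC_eq (by omega) hu, multiplierGroup]
  refine isCyclic_affineGroup ((isAdmissible_zero_two_pow hu _).isMultiplier (by omega))
    (d := 2 ^ (u - 2) * (2 * k + 1)) ?_
  obtain ⟨i, rfl⟩ := Nat.exists_eq_add_of_le hu
  rw [multiplier, Nat.add_sub_cancel_left, pow_add]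
  ring

theorem exceptionalGroup_eq_iff (hn : 4 ≤ n) (i j i' j' : C n) :
    exceptionalGroup n i j = exceptionalGroup n i' j' ↔
      8 * quarterStep n * i = 8 * quarterStep n * i' ∧
        8 * quarterStep n * j = 8 * quarterStep n * j' := by
  rw [exceptionalGroup, exceptionalGroup, (isAdmissible_exceptional hn _ _).multiplierGroup_eq_iff
    (by omega) (isAdmissible_exceptional hn _ _)]
  constructor
  · rintro ⟨h1, h2⟩
    exact ⟨by linear_combination h1, by linear_combination h2⟩
  · rintro ⟨h1, h2⟩
    exact ⟨by linear_combination h1, by linear_combination h2⟩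

theorem nodup_exceptional (hn : 4 ≤ n) : [N3 n, N4 n, N5 n, N6 n].Nodup := by
  have h8 := eight_mul_quarterStep_ne_zero hn
  simp [N3_eq hn, N4_eq hn, N5_eq hn, N6_eq hn, exceptionalGroup_eq_iff hn, h8, h8.symm]

theorem mem_exceptional_iff (hn : 4 ≤ n) (N : Subgroup (Perm (C n))) :
    N ∈ ({N3 n, N4 n, N5 n, N6 n} : Set (Subgroup (Perm (C n)))) ↔
      ∃ i j : C n, (i = 0 ∨ i = 1) ∧ (j = 0 ∨ j = 1) ∧ N = exceptionalGroup n i j := by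
  simp only [Set.mem_insert_iff, Set.mem_singleton_iff, N3_eq hn, N4_eq hn, N5_eq hn, N6_eq hn]
  constructor
  · rintro (h | h | h | h)
    · exact ⟨0, 1, .inl rfl, .inr rfl, h⟩
    · exact ⟨0, 0, .inl rfl, .inl rfl, h⟩
    · exact ⟨1, 1, .inr rfl, .inr rfl, h⟩
    · exact ⟨1, 0, .inr rfl, .inl rfl, h⟩
  · rintro ⟨i, j, rfl | rfl, rfl | rfl, h⟩ <;> simp [h]

theorem isAdmissible_zero_four_mul (t : C n) : IsAdmissible 0 (4 * t) := by
  rw [show 4 * t = 2 * (2 * t) by ring]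
  exact isAdmissible_zero_two_mul _

/-- The invariant β + ω modulo 4 is 0 for cyclic groups and 2 for all others; 2β modulo 8 separates
N3 to N6 from P and M; a common member of P and M would give 8q = 0. -/
theorem pairwise_disjoint_families (hn : 4 ≤ n) :
    [{N3 n, N4 n, N5 n, N6 n}, familyP n, familyM n, familyC n].Pairwise Disjoint := by
  have hn1 : 1 ≤ n := by omega
  have h8 := eight_mul_quarterStep_ne_zero hn
  have h2 := two_mul_odd_ne_zero hn
  simp only [List.pairwise_cons, List.mem_cons, List.not_mem_nil, or_false, forall_eq_or_imp,
    forall_eq, Set.disjoint_left, mem_familyP_iff hn, mem_familyM_iff hn, mem_familyC_iff hn,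
    mem_exceptional_iff hn, IsEmpty.forall_iff, implies_true, List.Pairwise.nil, and_true]
  refine ⟨⟨?_, ?_, ?_⟩, ⟨?_, ?_⟩, ?_⟩
  · rintro _ ⟨i, j, -, -, rfl⟩ ⟨t, h⟩
    rw [exceptionalGroup, (isAdmissible_exceptional hn _ _).multiplierGroup_eq_iff hn1
      (isAdmissible_zero_two_mul _)] at h
    refine eight_mul_odd_ne_zero hn (t - quarterStep n * i) ?_
    linear_combination -2 * h.1
  · rintro _ ⟨i, j, -, -, rfl⟩ ⟨t, h⟩
    rw [exceptionalGroup, (isAdmissible_exceptional hn _ _).multiplierGroup_eq_iff hn1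
      (isAdmissible_quarter_two_mul_odd hn _)] at h
    refine eight_mul_odd_ne_zero hn (t - quarterStep n * i) ?_
    linear_combination -2 * h.1
  · rintro _ ⟨i, j, -, -, rfl⟩ ⟨t, h⟩
    rw [exceptionalGroup, (isAdmissible_exceptional hn _ _).multiplierGroup_eq_iff hn1
      (isAdmissible_zero_four_mul _)] at h
    refine h2 (t - 2 * quarterStep n * j) ?_
    linear_combination -h.2
  · rintro _ ⟨s, rfl⟩ ⟨t, h⟩
    rw [(isAdmissible_zero_two_mul _).multiplierGroup_eq_iff hn1
      (isAdmissible_quarter_two_mul_odd hn _)] at h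
    exact h8 (by linear_combination h.1 - 2 * h.2)
  · rintro _ ⟨s, rfl⟩ ⟨t, h⟩
    rw [(isAdmissible_zero_two_mul _).multiplierGroup_eq_iff hn1
      (isAdmissible_zero_four_mul _)] at h
    exact h2 (s - t) (by linear_combination h.2)
  · rintro _ ⟨s, rfl⟩ ⟨t, h⟩
    rw [(isAdmissible_quarter_two_mul_odd hn _).multiplierGroup_eq_iff hn1
      (isAdmissible_zero_four_mul _)] at h
    exact h2 (s - t + quarterStep n) (by linear_combination h.2)

/-! ### Sizes of the cliques. -/

theorem mem_cliqueH_iff (hn : 4 ≤ n) (N : Subgroup (Perm (C n))) :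
    N ∈ cliqueH n ↔ ∃ t, N = multiplierGroup 0 (2 ^ ceilHalf n * t) := by
  rw [← exists_NC_iff (by omega) (by unfold ceilHalf; omega) (by unfold ceilHalf; omega)]
  rfl

theorem N1_mem_cliqueH (hn : 4 ≤ n) : N1 n ∈ cliqueH n :=
  ⟨n, 0, by unfold ceilHalf; omega, le_rfl, by positivity, (NC_top hn 0).symm⟩

theorem N2_mem_cliqueH (hn : 4 ≤ n) : N2 n ∈ cliqueH n :=
  ⟨n - 1, 0, by unfold ceilHalf; omega, by omega, by positivity, (NC_pred hn 0).symm⟩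

theorem ncard_cliqueH (hn : 4 ≤ n) : (cliqueH n).ncard = 2 ^ (n - ceilHalf n) := by
  have hw : 2 ≤ ceilHalf n := by unfold ceilHalf; omega
  have e : cliqueH n =
      (fun j : ℕ => multiplierGroup (n := n) 0 (2 ^ ceilHalf n * j)) ''
        (Set.Iio (2 ^ (n - ceilHalf n))) := by
    ext N
    rw [mem_cliqueH_iff hn]
    constructor
    · rintro ⟨t, rfl⟩
      obtain ⟨m, -, rfl⟩ := exists_natCast_lt t
      refine ⟨m % 2 ^ (n - ceilHalf n), Nat.mod_lt _ (by positivity), ?_⟩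
      simp only
      rw [(two_pow_mul_natCast_eq_iff _ _ m).2 (Nat.mod_modEq _ _)]
    · rintro ⟨j, -, rfl⟩
      exact ⟨j, rfl⟩
  rw [e, Set.InjOn.ncard_image]
  · rw [← Finset.coe_Iio, Set.ncard_coe_finset, Nat.card_Iio]
  · intro i hi j hj hij
    simp only [multiplierGroup_zero_left_inj (n := n) (by omega) hw hw] at hij
    rw [two_pow_mul_natCast_eq_iff] at hij
    exact hij.eq_of_lt_of_lt hi hj

/-- The group depends on k modulo 2^(n-u-1) = m·2^u with m = 2^(n-2u-1), so fixing k modulo m leaves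
2^u choices. -/
theorem ncard_cliqueA (hn : 4 ≤ n) {u t : ℕ} (hu : 2 ≤ u) (huh : u < ceilHalf n)
    (ht : t < 2 ^ (n - 2 * u - 1)) : (cliqueA n u t).ncard = 2 ^ u := by
  have hun : 2 * u + 1 ≤ n := by unfold ceilHalf at huh; omega
  set m := 2 ^ (n - 2 * u - 1) with hm
  have hpow : m * 2 ^ u = 2 ^ (n - u - 1) := by
    rw [hm, ← pow_add]; congr 1; omega
  have hlt : ∀ j < 2 ^ u, t + m * j < 2 ^ (n - u - 1) := fun j hj => by
    rw [← hpow]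
    calc t + m * j < m + m * j := by omega
      _ = m * (j + 1) := by ring
      _ ≤ m * 2 ^ u := Nat.mul_le_mul_left _ hj
  have hle : 2 ^ (n - u - 1) ≤ 2 ^ (n - 1) := Nat.pow_le_pow_right (by decide) (by omega)
  have e : cliqueA n u t = (fun j : ℕ => NC n u (t + m * j)) '' (Set.Iio (2 ^ u)) := by
    ext N
    constructor
    · rintro ⟨k, -, hkt, rfl⟩
      refine ⟨(k / m) % 2 ^ u, Nat.mod_lt _ (by positivity), ?_⟩
      refine (NC_eq_NC_iff hn _ _ hu (by omega) hu (by omega)).2 ⟨rfl, ?_⟩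
      have hk : k % m = t := by rw [hkt, Nat.mod_eq_of_lt ht]
      conv_rhs => rw [← Nat.mod_add_div k m, hk]
      refine Nat.ModEq.add_left t ?_
      rw [← hpow]
      exact (Nat.mod_modEq (k / m) (2 ^ u)).mul_left' m
    · rintro ⟨j, hj, rfl⟩
      exact ⟨t + m * j, (hlt j hj).trans_le hle, by simp [Nat.ModEq, ← hm], rfl⟩
  rw [e, Set.InjOn.ncard_image]
  · rw [← Finset.coe_Iio, Set.ncard_coe_finset, Nat.card_Iio]
  · intro i hi j hj hij
    have h1 := ((NC_eq_NC_iff hn _ _ hu (by omega) hu (by omega)).1 hij).2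
    have h2 := h1.eq_of_lt_of_lt (hlt i hi) (hlt j hj)
    exact Nat.eq_of_mul_eq_mul_left (by positivity : 0 < m) (by omega)

theorem four_mul_two_pow_sub_four (n : ℕ) : 4 * ((2 ^ (n - 4) : ℕ) : C n) = 4 * quarterStep n := by
  rw [quarterStep]
  push_cast
  rfl

theorem four_mul_two_pow_sub_three (hn : 4 ≤ n) :
    4 * ((2 ^ (n - 3) : ℕ) : C n) = 8 * quarterStep n := by
  rw [← two_pow_sub_one hn, show n - 1 = (n - 3) + 2 by omega, pow_add]
  push_cast
  ring

theorem cliqueS_eq (hn : 4 ≤ n) (k : ℕ) {β : C n} (hβ : β = 2 * (2 * k + 1)) :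
    cliqueS n k = {multiplierGroup 0 β,
      multiplierGroup (4 * quarterStep n) (β + 4 * quarterStep n),
      multiplierGroup 0 (β + 8 * quarterStep n),
      multiplierGroup (4 * quarterStep n) (β + 12 * quarterStep n)} := by
  have h3 := four_mul_two_pow_sub_three hn
  have h4 := four_mul_two_pow_sub_four n
  push_cast at h3 h4
  have e1 : 2 * (2 * ((k + 2 ^ (n - 4) : ℕ) : C n) + 1) = β + 4 * quarterStep n := by
    push_cast
    linear_combination h4 - hβ
  have e2 : 2 * (2 * ((k + 2 ^ (n - 3) : ℕ) : C n) + 1) = β + 8 * quarterStep n := by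
    push_cast
    linear_combination h3 - hβ
  have e3 : 2 * (2 * ((k + 2 ^ (n - 3) + 2 ^ (n - 4) : ℕ) : C n) + 1) =
      β + 12 * quarterStep n := by
    push_cast
    linear_combination h3 + h4 - hβ
  rw [cliqueS, NP_eq hn, NM_eq hn, NP_eq hn, NM_eq hn, ← hβ, e1, e2, e3]

theorem ncard_cliqueS (hn : 4 ≤ n) (k : ℕ) : (cliqueS n k).ncard = 4 := by
  have hd := pairwise_disjoint_families hn
  have hlt : ∀ i < 2 ^ (n - 2), 0 < i → ∀ k, ¬ k ≡ k + i [MOD 2 ^ (n - 2)] := by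
    intro i hi h0 k h
    have h1 : 0 ≡ i [MOD 2 ^ (n - 2)] := Nat.ModEq.add_left_cancel' k h
    have := h1.eq_of_lt_of_lt (by positivity) hi
    omega
  have h32 : (2 : ℕ) ^ (n - 3) < 2 ^ (n - 2) := Nat.pow_lt_pow_right (by decide) (by omega)
  have hP : NP n k ≠ NP n (k + 2 ^ (n - 3)) := by
    rw [Ne, NP_eq_NP_iff hn]
    exact hlt _ h32 (by positivity) k
  have hM : NM n (k + 2 ^ (n - 4)) ≠ NM n (k + 2 ^ (n - 3) + 2 ^ (n - 4)) := by
    rw [Ne, NM_eq_NM_iff hn, add_right_comm]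
    exact hlt _ h32 (by positivity) _
  have hPM : ∀ i j, NP n i ≠ NM n j := by
    intro i j h
    have hdis : Disjoint (familyP n) (familyM n) := by
      simp only [List.pairwise_cons, List.mem_cons, forall_eq_or_imp] at hd
      exact hd.2.1.1
    refine Set.disjoint_left.1 hdis ((mem_familyP_iff hn _).2 ⟨i, NP_eq hn i⟩) ?_
    rw [h]
    exact (mem_familyM_iff hn _).2 ⟨j, NM_eq hn j⟩
  rw [cliqueS, Set.ncard_insert_of_notMem, Set.ncard_insert_of_notMem, Set.ncard_pair (hPM _ _)]
  · simp only [Set.mem_insert_iff, Set.mem_singleton_iff, not_or]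
    exact ⟨(hPM _ _).symm, hM⟩
  · simp only [Set.mem_insert_iff, Set.mem_singleton_iff, not_or]
    exact ⟨hPM _ _, hP, hPM _ _⟩

/-! ### Mutual normalization within each listed set. -/

/-- Two permutation groups normalize each other. -/
def MutuallyNormal {X : Type*} (N M : Subgroup (Perm X)) : Prop :=
  N ≤ Subgroup.normalizer (M : Set (Perm X)) ∧ M ≤ Subgroup.normalizer (N : Set (Perm X))

theorem MutuallyNormal.symm {X : Type*} {N M : Subgroup (Perm X)} (h : MutuallyNormal N M) :
    MutuallyNormal M N :=
  ⟨h.2, h.1⟩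

theorem IsAdmissible.mutuallyNormal_iff (hn : 1 ≤ n) {ω β ω' β' : C n} (h : IsAdmissible ω β)
    (h' : IsAdmissible ω' β') :
    MutuallyNormal (multiplierGroup ω β) (multiplierGroup ω' β') ↔
      (2 * β' * ω = 0 ∧ β' * (β + ω - (β' + ω')) = 0) ∧
        2 * β * ω' = 0 ∧ β * (β' + ω' - (β + ω)) = 0 := by
  rw [MutuallyNormal, h'.le_normalizer_iff hn h, h.le_normalizer_iff hn h']

/-- Two groups lie together in one of the listed cliques. -/
def InCommonClique (N M : Subgroup (Perm (C n))) : Prop := ∃ K ∈ cliques n, N ∈ K ∧ M ∈ K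

theorem InCommonClique.symm {N M : Subgroup (Perm (C n))} (h : InCommonClique N M) :
    InCommonClique M N := by
  obtain ⟨K, hK, hN, hM⟩ := h
  exact ⟨K, hK, hM, hN⟩

section CliquesAreCliques

/-- All four groups have ω even and β a multiple of 8q, which annihilates every even element. -/
theorem mutuallyNormal_of_mem_first (hn : 4 ≤ n) {N M : Subgroup (Perm (C n))}
    (hN : N ∈ ({N1 n, N2 n, N3 n, N4 n} : Set (Subgroup (Perm (C n)))))
    (hM : M ∈ ({N1 n, N2 n, N3 n, N4 n} : Set (Subgroup (Perm (C n))))) : MutuallyNormal N M := by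
  have hq := sixteen_mul_quarterStep hn
  have key : ∀ N ∈ ({N1 n, N2 n, N3 n, N4 n} : Set (Subgroup (Perm (C n)))),
      ∃ w y, IsAdmissible (2 * w) (8 * quarterStep n * y) ∧
        N = multiplierGroup (2 * w) (8 * quarterStep n * y) := by
    have hex : ∀ j : C n, ∃ w y, IsAdmissible (2 * w) (8 * quarterStep n * y) ∧
        exceptionalGroup n 0 j = multiplierGroup (2 * w) (8 * quarterStep n * y) := by
      intro j
      have h := isAdmissible_exceptional hn 0 j
      refine ⟨4 * quarterStep n * j - 1, 0, ?_, ?_⟩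
      · convert h using 1 <;> ring
      · rw [exceptionalGroup]
        congr 1 <;> ring
    have hcyc : ∀ d y : C n, d = 8 * quarterStep n * y →
        ∃ w y, IsAdmissible (2 * w) (8 * quarterStep n * y) ∧
        multiplierGroup 0 d = multiplierGroup (2 * w) (8 * quarterStep n * y) := by
      rintro _ y rfl
      refine ⟨0, y, ?_, ?_⟩
      · convert isAdmissible_zero_four_mul (2 * quarterStep n * y) using 1 <;> ring
      · rw [mul_zero]
    rintro N (rfl | rfl | rfl | rfl)
    · rw [N1_eq]; exact hcyc 0 0 (by ring)
    · rw [N2_eq hn]; exact hcyc _ 1 (by ring)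
    · rw [N3_eq hn]; exact hex 1
    · rw [N4_eq hn]; exact hex 0
  obtain ⟨w, y, h, rfl⟩ := key N hN
  obtain ⟨w', y', h', rfl⟩ := key M hM
  rw [h.mutuallyNormal_iff (by omega) h']
  refine ⟨⟨?_, ?_⟩, ?_, ?_⟩
  · linear_combination 2 * y' * w * hq
  · linear_combination
      y' * (4 * quarterStep n * y + w - (4 * quarterStep n * y' + w')) * hq
  · linear_combination 2 * y * w' * hq
  · linear_combination
      y * (4 * quarterStep n * y' + w' - (4 * quarterStep n * y + w)) * hq

/-- Here β is a multiple of 4q, ω is even, and the sums β + ω agree modulo 8q, so every product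
contains 16q. -/
theorem mutuallyNormal_of_mem_exceptional (hn : 4 ≤ n) {N M : Subgroup (Perm (C n))}
    (hN : N ∈ ({N3 n, N4 n, N5 n, N6 n} : Set (Subgroup (Perm (C n)))))
    (hM : M ∈ ({N3 n, N4 n, N5 n, N6 n} : Set (Subgroup (Perm (C n))))) :
    MutuallyNormal N M := by
  have hq := sixteen_mul_quarterStep hn
  obtain ⟨i, j, -, -, rfl⟩ := (mem_exceptional_iff hn N).1 hN
  obtain ⟨i', j', -, -, rfl⟩ := (mem_exceptional_iff hn M).1 hM
  rw [exceptionalGroup, exceptionalGroup, (isAdmissible_exceptional hn i j).mutuallyNormal_iff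
    (by omega) (isAdmissible_exceptional hn i' j')]
  refine ⟨⟨?_, ?_⟩, ?_, ?_⟩
  · linear_combination i' * (4 * quarterStep n * j - 1 - 2 * quarterStep n * i) * hq
  · linear_combination 2 * i' * quarterStep n * (j - j') * hq
  · linear_combination i * (4 * quarterStep n * j' - 1 - 2 * quarterStep n * i') * hq
  · linear_combination 2 * i * quarterStep n * (j' - j) * hq

theorem mutuallyNormal_of_mem_cliqueH (hn : 4 ≤ n) {N M : Subgroup (Perm (C n))}
    (hN : N ∈ cliqueH n) (hM : M ∈ cliqueH n) : MutuallyNormal N M := by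
  obtain ⟨t, rfl⟩ := (mem_cliqueH_iff hn N).1 hN
  obtain ⟨s, rfl⟩ := (mem_cliqueH_iff hn M).1 hM
  have hw : 2 ≤ ceilHalf n := by unfold ceilHalf; omega
  have hsq : (2 : C n) ^ ceilHalf n * 2 ^ ceilHalf n = 0 := by
    obtain ⟨i, hi⟩ : ∃ i, ceilHalf n + ceilHalf n = n + i :=
      Nat.exists_eq_add_of_le (by unfold ceilHalf; omega)
    rw [← pow_add, hi, pow_add, two_pow_self_eq_zero, zero_mul]
  rw [(isAdmissible_zero_two_pow hw _).mutuallyNormal_iff (by omega)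
    (isAdmissible_zero_two_pow hw _)]
  refine ⟨⟨by ring, ?_⟩, by ring, ?_⟩
  · linear_combination s * (t - s) * hsq
  · linear_combination t * (s - t) * hsq

/-- Each member has ω = 4qe and β = 2(2k + 1) + 4qe + 8qz. Hence the sums β + ω agree modulo 8q, and
their differences are killed by the even β. -/
theorem mutuallyNormal_of_mem_cliqueS (hn : 4 ≤ n) {k : ℕ} {N M : Subgroup (Perm (C n))}
    (hN : N ∈ cliqueS n k) (hM : M ∈ cliqueS n k) : MutuallyNormal N M := by
  have hq := sixteen_mul_quarterStep hn
  have key : ∀ N ∈ cliqueS n k, ∃ e z b : C n,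
      2 * b = 2 * (2 * k + 1) + 4 * quarterStep n * e + 8 * quarterStep n * z ∧
        IsAdmissible (4 * quarterStep n * e) (2 * b) ∧
        N = multiplierGroup (4 * quarterStep n * e) (2 * b) := by
    have hP : ∀ i : ℕ, ∃ b, 2 * b = 2 * (2 * (i : C n) + 1) ∧
        IsAdmissible (4 * quarterStep n * 0) (2 * b) ∧
        NP n i = multiplierGroup (4 * quarterStep n * 0) (2 * b) := by
      intro i
      rw [NP_eq hn, mul_zero]
      exact ⟨_, rfl, isAdmissible_zero_two_mul _, rfl⟩
    have hM : ∀ i : ℕ, ∃ b, 2 * b = 2 * (2 * (i : C n) + 1) ∧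
        IsAdmissible (4 * quarterStep n * 1) (2 * b) ∧
        NM n i = multiplierGroup (4 * quarterStep n * 1) (2 * b) := by
      intro i
      rw [NM_eq hn, mul_one]
      exact ⟨_, rfl, isAdmissible_quarter_two_mul_odd hn _, rfl⟩
    have h3 := four_mul_two_pow_sub_three hn
    have h4 := four_mul_two_pow_sub_four n
    rintro N (rfl | rfl | rfl | rfl)
    · obtain ⟨b, hb, h⟩ := hP k
      exact ⟨0, 0, b, by linear_combination hb, h⟩
    · obtain ⟨b, hb, h⟩ := hM (k + 2 ^ (n - 4))
      push_cast at hb h4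
      exact ⟨1, 0, b, by linear_combination hb + h4, h⟩
    · obtain ⟨b, hb, h⟩ := hP (k + 2 ^ (n - 3))
      push_cast at hb h3
      exact ⟨0, 1, b, by linear_combination hb + h3, h⟩
    · obtain ⟨b, hb, h⟩ := hM (k + 2 ^ (n - 3) + 2 ^ (n - 4))
      push_cast at hb h3 h4
      exact ⟨1, 1, b, by linear_combination hb + h3 + h4, h⟩
  obtain ⟨e, z, b, hb, h, rfl⟩ := key N hN
  obtain ⟨e', z', b', hb', h', rfl⟩ := key M hM
  rw [h.mutuallyNormal_iff (by omega) h']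
  refine ⟨⟨?_, ?_⟩, ?_, ?_⟩
  · linear_combination b' * e * hq
  · linear_combination 2 * b' * (hb - hb') + b' * (e - e' + z - z') * hq
  · linear_combination b * e' * hq
  · linear_combination 2 * b * (hb' - hb) + b * (e' - e + z' - z) * hq

theorem mutuallyNormal_of_mem_cliqueA (hn : 1 ≤ n) {u t : ℕ} (hu : 2 ≤ u)
    {N M : Subgroup (Perm (C n))} (hN : N ∈ cliqueA n u t) (hM : M ∈ cliqueA n u t) :
    MutuallyNormal N M := by
  obtain ⟨k, -, hk, rfl⟩ := hN
  obtain ⟨h, -, hh, rfl⟩ := hM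
  have e : k ≡ h [MOD 2 ^ (n - (2 * u + 1))] := by
    rw [← Nat.sub_sub]
    exact hk.trans hh.symm
  rw [← two_pow_mul_natCast_eq_iff, pow_succ, two_mul, pow_add] at e
  rw [NC_eq (by omega) hu, NC_eq (by omega) hu,
    (isAdmissible_zero_two_pow hu _).mutuallyNormal_iff (by omega)
      (isAdmissible_zero_two_pow hu _)]
  refine ⟨⟨by ring, ?_⟩, by ring, ?_⟩
  · linear_combination (2 * (h : C n) + 1) * e
  · linear_combination -(2 * (k : C n) + 1) * e

theorem InCommonClique.mutuallyNormal (hn : 4 ≤ n) {N M : Subgroup (Perm (C n))}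
    (h : InCommonClique N M) : MutuallyNormal N M := by
  obtain ⟨K, ((rfl | rfl | rfl) | ⟨k, -, rfl⟩) | ⟨u, t, hu, -, -, rfl⟩, hN, hM⟩ := h
  · exact mutuallyNormal_of_mem_first hn hN hM
  · exact mutuallyNormal_of_mem_exceptional hn hN hM
  · exact mutuallyNormal_of_mem_cliqueH hn hN hM
  · exact mutuallyNormal_of_mem_cliqueS hn hN hM
  · exact mutuallyNormal_of_mem_cliqueA (by omega) hu hN hM

end CliquesAreCliques

/-! ### Every edge lies in a listed clique. -/

section EdgesLieInCliques

theorem inCommonClique_of_mem_cliqueS {k : ℕ} (hk : k < 2 ^ (n - 1)) {N M : Subgroup (Perm (C n))}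
    (hN : N ∈ cliqueS n k) (hM : M ∈ cliqueS n k) : InCommonClique N M :=
  ⟨_, .inl (.inr ⟨k, hk, rfl⟩), hN, hM⟩

theorem inCommonClique_of_mem_first {N M : Subgroup (Perm (C n))}
    (hN : N ∈ ({N1 n, N2 n, N3 n, N4 n} : Set (Subgroup (Perm (C n)))))
    (hM : M ∈ ({N1 n, N2 n, N3 n, N4 n} : Set (Subgroup (Perm (C n))))) : InCommonClique N M :=
  ⟨_, .inl (.inl (.inl rfl)), hN, hM⟩

theorem inCommonClique_exceptional (hn : 4 ≤ n) {i j i' j' : C n} (hi : i = 0 ∨ i = 1)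
    (hj : j = 0 ∨ j = 1) (hi' : i' = 0 ∨ i' = 1) (hj' : j' = 0 ∨ j' = 1) :
    InCommonClique (exceptionalGroup n i j) (exceptionalGroup n i' j') :=
  ⟨_, .inl (.inl (.inr (.inl rfl))), (mem_exceptional_iff hn _).2 ⟨i, j, hi, hj, rfl⟩,
    (mem_exceptional_iff hn _).2 ⟨i', j', hi', hj', rfl⟩⟩

/-- If u < v the expression is 2^(2u) times an odd element, nonzero because 2u < n. If u = v it
vanishes exactly when the indices agree modulo 2^(n-2u-1). -/
theorem inCommonClique_NC_of_lt {u v k h : ℕ} (hu : 2 ≤ u) (huh : u < ceilHalf n)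
    (huv : u ≤ v) (hk : k < 2 ^ (n - 1)) (hh : h < 2 ^ (n - 1))
    (e : (2 : C n) ^ u * (2 ^ v * (2 * h + 1) - 2 ^ u * (2 * k + 1)) = 0) :
    InCommonClique (NC n u k) (NC n v h) := by
  have hun : 2 * u + 1 ≤ n := by unfold ceilHalf at huh; omega
  rcases huv.lt_or_eq with huv | rfl
  · refine (two_pow_mul_odd_ne_of_lt (u := u + u) (v := u + v) (n := n) (by omega) (by omega)
      (k : C n) (2 * h + 1) ?_).elim
    rw [pow_add, pow_add]
    linear_combination -e
  · have hkh : h ≡ k [MOD 2 ^ (n - 2 * u - 1)] := by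
      rw [Nat.sub_sub, ← two_pow_mul_natCast_eq_iff, pow_succ, two_mul, pow_add]
      linear_combination e
    refine ⟨cliqueA n u (k % 2 ^ (n - 2 * u - 1)),
      .inr ⟨u, _, hu, huh, Nat.mod_lt _ (by positivity), rfl⟩, ?_, ?_⟩
    · exact ⟨k, hk, (Nat.mod_modEq _ _).symm, rfl⟩
    · exact ⟨h, hh, hkh.trans (Nat.mod_modEq _ _).symm, rfl⟩

theorem inCommonClique_cyclic_cyclic (hn : 4 ≤ n) {t s : C n}
    (H : MutuallyNormal (multiplierGroup 0 (4 * t)) (multiplierGroup 0 (4 * s))) :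
    InCommonClique (multiplierGroup 0 (4 * t)) (multiplierGroup 0 (4 * s)) := by
  obtain ⟨u, k, hu, hun, hk, ht⟩ := exists_two_pow_mul_odd_eq (w := 2) (by omega) t
  obtain ⟨v, h, hv, hvn, hh, hs⟩ := exists_two_pow_mul_odd_eq (w := 2) (by omega) s
  rw [show (2 : C n) ^ 2 = 4 by norm_num] at ht hs
  rw [ht, hs] at H ⊢
  rw [(isAdmissible_zero_two_pow hu _).mutuallyNormal_iff (by omega)
    (isAdmissible_zero_two_pow hv _)] at H
  obtain ⟨⟨-, H1⟩, -, H2⟩ := H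
  rw [← NC_eq (by omega) hu, ← NC_eq (by omega) hv]
  rcases le_or_gt (ceilHalf n) u with hcu | hcu <;> rcases le_or_gt (ceilHalf n) v with hcv | hcv
  · exact ⟨cliqueH n, .inl (.inl (.inr (.inr rfl))), ⟨u, k, hcu, hun, hk, rfl⟩,
      ⟨v, h, hcv, hvn, hh, rfl⟩⟩
  · refine (inCommonClique_NC_of_lt hv hcv (by omega) hh hk ?_).symm
    exact eq_zero_of_mul_odd (h : C n) (by linear_combination H1)
  · refine inCommonClique_NC_of_lt hu hcu (by omega) hk hh ?_
    exact eq_zero_of_mul_odd (k : C n) (by linear_combination H2)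
  · rcases le_total u v with huv | huv
    · refine inCommonClique_NC_of_lt hu hcu huv hk hh ?_
      exact eq_zero_of_mul_odd (k : C n) (by linear_combination H2)
    · refine (inCommonClique_NC_of_lt hv hcv huv hh hk ?_).symm
      exact eq_zero_of_mul_odd (h : C n) (by linear_combination H1)

/-- With β = 2·odd from the P group, the second normalizing condition would make 4 times an odd
element vanish. -/
theorem not_mutuallyNormal_cyclic_P (hn : 4 ≤ n) (t s : C n) :
    ¬ MutuallyNormal (multiplierGroup 0 (4 * t)) (multiplierGroup 0 (2 * (2 * s + 1))) := by
  intro H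
  rw [(isAdmissible_zero_four_mul _).mutuallyNormal_iff (by omega)
    (isAdmissible_zero_two_mul _)] at H
  refine eight_mul_odd_ne_zero hn (s - t) (eq_zero_of_mul_odd s ?_)
  linear_combination -2 * H.1.2

theorem not_mutuallyNormal_cyclic_M (hn : 4 ≤ n) (t s : C n) :
    ¬ MutuallyNormal (multiplierGroup 0 (4 * t))
      (multiplierGroup (4 * quarterStep n) (2 * (2 * s + 1))) := by
  intro H
  rw [(isAdmissible_zero_four_mul _).mutuallyNormal_iff (by omega)
    (isAdmissible_quarter_two_mul_odd hn _)] at H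
  refine eight_mul_odd_ne_zero hn (s - t + quarterStep n) (eq_zero_of_mul_odd s ?_)
  linear_combination -2 * H.1.2

/-- The exceptional ω' is twice an odd element, so 2βω' is 8 times an odd element. -/
theorem not_mutuallyNormal_P_exceptional (hn : 4 ≤ n) (s i j : C n) :
    ¬ MutuallyNormal (multiplierGroup 0 (2 * (2 * s + 1))) (exceptionalGroup n i j) := by
  intro H
  rw [exceptionalGroup, (isAdmissible_zero_two_mul _).mutuallyNormal_iff (by omega)
    (isAdmissible_exceptional hn _ _)] at H
  refine eight_mul_odd_ne_zero hn (2 * quarterStep n * j - 1 - quarterStep n * i)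
    (eq_zero_of_mul_odd s ?_)
  linear_combination H.2.1

theorem not_mutuallyNormal_M_exceptional (hn : 4 ≤ n) (s i j : C n) :
    ¬ MutuallyNormal (multiplierGroup (4 * quarterStep n) (2 * (2 * s + 1)))
      (exceptionalGroup n i j) := by
  intro H
  rw [exceptionalGroup, (isAdmissible_quarter_two_mul_odd hn _).mutuallyNormal_iff (by omega)
    (isAdmissible_exceptional hn _ _)] at H
  refine eight_mul_odd_ne_zero hn (2 * quarterStep n * j - 1 - quarterStep n * i)
    (eq_zero_of_mul_odd s ?_)
  linear_combination H.2.1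

/-- The two second conditions reduce to 8t = 0, which leaves N1 and N2, and 8qi = 0, which leaves N3
and N4. -/
theorem inCommonClique_cyclic_exceptional (hn : 4 ≤ n) {t i j : C n} (hi : i = 0 ∨ i = 1)
    (hj : j = 0 ∨ j = 1)
    (H : MutuallyNormal (multiplierGroup 0 (4 * t)) (exceptionalGroup n i j)) :
    InCommonClique (multiplierGroup 0 (4 * t)) (exceptionalGroup n i j) := by
  rw [exceptionalGroup, (isAdmissible_zero_four_mul _).mutuallyNormal_iff (by omega)
    (isAdmissible_exceptional hn _ _)] at H
  have ht : 8 * t = 0 := eq_zero_of_mul_odd (2 * quarterStep n * j - 1 - t)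
    (by linear_combination H.2.2)
  have hi0 : 8 * quarterStep n * i = 0 := eq_zero_of_mul_odd (t - 2 * quarterStep n * j)
    (by linear_combination H.1.2)
  have hi : i = 0 := by
    rcases hi with hi | rfl
    · exact hi
    · exact (eight_mul_quarterStep_ne_zero hn (by rw [← hi0, mul_one])).elim
  subst hi
  apply inCommonClique_of_mem_first
  · rcases eq_zero_or_eq_of_two_mul_eq_zero hn (x := 4 * t) (by linear_combination ht) with h | h
    · rw [h, ← N1_eq]; simp
    · rw [h, ← N2_eq hn]; simp
  · rcases hj with rfl | rfl
    · rw [← N4_eq hn]; simp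
    · rw [← N3_eq hn]; simp

theorem exists_cliqueS (hn : 4 ≤ n) (t : C n) : ∃ k < 2 ^ (n - 1), cliqueS n k =
    {multiplierGroup 0 (2 * (2 * t + 1)),
      multiplierGroup (4 * quarterStep n) (2 * (2 * t + 1) + 4 * quarterStep n),
      multiplierGroup 0 (2 * (2 * t + 1) + 8 * quarterStep n),
      multiplierGroup (4 * quarterStep n) (2 * (2 * t + 1) + 12 * quarterStep n)} := by
  obtain ⟨k, hk, h⟩ := exists_natCast_lt_two_pow_mul_eq (n := n) (j := 2) (by omega) t
  exact ⟨k, hk, cliqueS_eq hn k (by linear_combination h)⟩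

theorem inCommonClique_P_P (hn : 4 ≤ n) {s t : C n}
    (H : MutuallyNormal (multiplierGroup 0 (2 * (2 * s + 1)))
      (multiplierGroup 0 (2 * (2 * t + 1)))) :
    InCommonClique (multiplierGroup 0 (2 * (2 * s + 1)))
      (multiplierGroup 0 (2 * (2 * t + 1))) := by
  rw [(isAdmissible_zero_two_mul _).mutuallyNormal_iff (by omega)
    (isAdmissible_zero_two_mul _)] at H
  obtain ⟨k, hk, hS⟩ := exists_cliqueS hn s
  apply inCommonClique_of_mem_cliqueS hk
  · rw [hS]; simp
  · have h : 2 * (2 * (2 * t + 1) - 2 * (2 * s + 1)) = 0 :=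
      eq_zero_of_mul_odd s (by linear_combination H.2.2)
    rw [hS]
    rcases eq_zero_or_eq_of_two_mul_eq_zero hn h with h | h
    · rw [sub_eq_zero.1 h]; simp
    · rw [eq_add_of_sub_eq' h]; simp

theorem inCommonClique_M_M (hn : 4 ≤ n) {s t : C n}
    (H : MutuallyNormal (multiplierGroup (4 * quarterStep n) (2 * (2 * s + 1)))
      (multiplierGroup (4 * quarterStep n) (2 * (2 * t + 1)))) :
    InCommonClique (multiplierGroup (4 * quarterStep n) (2 * (2 * s + 1)))
      (multiplierGroup (4 * quarterStep n) (2 * (2 * t + 1))) := by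
  rw [(isAdmissible_quarter_two_mul_odd hn _).mutuallyNormal_iff (by omega)
    (isAdmissible_quarter_two_mul_odd hn _)] at H
  -- The base point is shifted by q so that the first M group is the second listed member of the
  -- clique.
  obtain ⟨k, hk, hS⟩ := exists_cliqueS hn (s - quarterStep n)
  have e : 2 * (2 * (s - quarterStep n) + 1) + 4 * quarterStep n = 2 * (2 * s + 1) := by ring
  have e' : 2 * (2 * (s - quarterStep n) + 1) + 12 * quarterStep n =
    2 * (2 * s + 1) + 8 * quarterStep n := by ring
  rw [e, e'] at hS
  apply inCommonClique_of_mem_cliqueS hk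
  · rw [hS]; simp
  · have h : 2 * (2 * (2 * t + 1) - 2 * (2 * s + 1)) = 0 :=
      eq_zero_of_mul_odd s (by linear_combination H.2.2)
    rw [hS]
    rcases eq_zero_or_eq_of_two_mul_eq_zero hn h with h | h
    · rw [sub_eq_zero.1 h]; simp
    · rw [eq_add_of_sub_eq' h]; simp

/-- After cancelling the odd part of β, β' + 4q - β is killed by 2, hence is 0 or 8q. So β' is β +
12q or β + 4q, the two M members of the clique. -/
theorem inCommonClique_P_M (hn : 4 ≤ n) {s t : C n}
    (H : MutuallyNormal (multiplierGroup 0 (2 * (2 * s + 1)))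
      (multiplierGroup (4 * quarterStep n) (2 * (2 * t + 1)))) :
    InCommonClique (multiplierGroup 0 (2 * (2 * s + 1)))
      (multiplierGroup (4 * quarterStep n) (2 * (2 * t + 1))) := by
  rw [(isAdmissible_zero_two_mul _).mutuallyNormal_iff (by omega)
    (isAdmissible_quarter_two_mul_odd hn _)] at H
  obtain ⟨k, hk, hS⟩ := exists_cliqueS hn s
  apply inCommonClique_of_mem_cliqueS hk
  · rw [hS]; simp
  · have h : 2 * (2 * (2 * t + 1) + 4 * quarterStep n - 2 * (2 * s + 1)) = 0 :=
      eq_zero_of_mul_odd s (by linear_combination H.2.2)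
    rw [hS]
    rcases eq_zero_or_eq_of_two_mul_eq_zero hn h with h | h
    · rw [show 2 * (2 * t + 1) = 2 * (2 * s + 1) + 12 * quarterStep n by
        linear_combination h - sixteen_mul_quarterStep hn]
      simp
    · rw [show 2 * (2 * t + 1) = 2 * (2 * s + 1) + 4 * quarterStep n by linear_combination h]
      simp

theorem MutuallyNormal.inCommonClique (hn : 4 ≤ n) {N M : Subgroup (Perm (C n))}
    (hN : N ∈ regularSubgroups (C n)) (hM : M ∈ regularSubgroups (C n))
    (h : MutuallyNormal N M) : InCommonClique N M := by
  rw [mem_regularSubgroups_iff hn] at hN hM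
  rcases hN with ⟨t, rfl⟩ | ⟨t, rfl⟩ | ⟨t, rfl⟩ | ⟨i, j, hi, hj, rfl⟩ <;>
    rcases hM with ⟨s, rfl⟩ | ⟨s, rfl⟩ | ⟨s, rfl⟩ | ⟨i', j', hi', hj', rfl⟩
  · exact inCommonClique_cyclic_cyclic hn h
  · exact (not_mutuallyNormal_cyclic_P hn _ _ h).elim
  · exact (not_mutuallyNormal_cyclic_M hn _ _ h).elim
  · exact inCommonClique_cyclic_exceptional hn hi' hj' h
  · exact (not_mutuallyNormal_cyclic_P hn _ _ h.symm).elim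
  · exact inCommonClique_P_P hn h
  · exact inCommonClique_P_M hn h
  · exact (not_mutuallyNormal_P_exceptional hn _ _ _ h).elim
  · exact (not_mutuallyNormal_cyclic_M hn _ _ h.symm).elim
  · exact (inCommonClique_P_M hn h.symm).symm
  · exact inCommonClique_M_M hn h
  · exact (not_mutuallyNormal_M_exceptional hn _ _ _ h).elim
  · exact (inCommonClique_cyclic_exceptional hn hi hj h.symm).symm
  · exact (not_mutuallyNormal_P_exceptional hn _ _ _ h.symm).elim
  · exact (not_mutuallyNormal_M_exceptional hn _ _ _ h.symm).elim
  · exact inCommonClique_exceptional hn hi hj hi' hj'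

end EdgesLieInCliques

/-! ### Assembly of the main theorem. -/

theorem adj_iff (hn : 4 ≤ n) (N M : regularSubgroups (C n)) :
    (localNormalizingGraph (C n)).Adj N M ↔ N ≠ M ∧ ∃ K ∈ cliques n, N.1 ∈ K ∧ M.1 ∈ K :=
  and_congr_right fun _ =>
    ⟨MutuallyNormal.inCommonClique hn N.2 M.2, InCommonClique.mutuallyNormal hn⟩

theorem isGammaFunction_all (hn : 4 ≤ n) :
    IsGammaFunction (gamma1 n) ∧ IsGammaFunction (gamma2 n) ∧ IsGammaFunction (gamma3 n) ∧
      IsGammaFunction (gamma4 n) ∧ IsGammaFunction (gamma5 n) ∧ IsGammaFunction (gamma6 n) ∧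
      IsGammaFunction (gammaP n) ∧ IsGammaFunction (gammaM n) ∧
      ∀ u, 2 ≤ u → u ≤ n → IsGammaFunction (gammaC n u) := by
  have hn1 : 1 ≤ n := by omega
  have key : ∀ {ω β : C n}, IsAdmissible ω β →
      IsGammaFunction fun x => sigma (multiplier ω β x) :=
    fun h => (h.isMultiplier hn1).isGammaFunction
  have hex : ∀ i j : C n, ∀ {ω β : C n},
      ω = 8 * quarterStep n * j - 2 - 4 * quarterStep n * i → β = 4 * quarterStep n * i →
      IsGammaFunction fun x => sigma (multiplier ω β x) := by
    rintro i j _ _ rfl rfl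
    exact key (isAdmissible_exceptional hn i j)
  rw [gamma1_eq, gamma2_eq hn, gamma3_eq hn, gamma4_eq hn, gamma5_eq hn, gamma6_eq hn, gammaP_eq,
    gammaM_eq hn]
  refine ⟨key isAdmissible_zero_zero, key ?_, hex 0 1 ?_ ?_, hex 0 0 ?_ ?_, hex 1 1 ?_ ?_,
    hex 1 0 ?_ ?_, key isAdmissible_zero_two, key (isAdmissible_quarter_two hn),
    fun u hu _ => ?_⟩
  · convert isAdmissible_zero_four_mul (2 * quarterStep n) using 1
    ring
  any_goals ring
  rw [gammaC_eq]
  exact key (by simpa using isAdmissible_zero_two_pow hu (1 : C n))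

end CyclicHol

theorem mainTheorem2 (n : ℕ) (hn : 4 ≤ n) :
    -- the listed functions are gamma functions
    (IsGammaFunction (gamma1 n) ∧ IsGammaFunction (gamma2 n) ∧ IsGammaFunction (gamma3 n) ∧
      IsGammaFunction (gamma4 n) ∧ IsGammaFunction (gamma5 n) ∧ IsGammaFunction (gamma6 n) ∧
      IsGammaFunction (gammaP n) ∧ IsGammaFunction (gammaM n) ∧
      ∀ u, 2 ≤ u → u ≤ n → IsGammaFunction (gammaC n u)) ∧
    -- the vertices
    regularSubgroups (C n) =
      {N1 n, N2 n, N3 n, N4 n, N5 n, N6 n} ∪ familyP n ∪ familyM n ∪ familyC n ∧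
    (∀ u k, 2 ≤ u → u ≤ n → IsCyclic (NC n u k)) ∧
    -- coincidences among the names of the vertices: exactly the following
    (∀ k, NC n n k = N1 n) ∧ (∀ k, NC n (n - 1) k = N2 n) ∧
    [N3 n, N4 n, N5 n, N6 n].Nodup ∧
    [{N3 n, N4 n, N5 n, N6 n}, familyP n, familyM n, familyC n].Pairwise Disjoint ∧
    (∀ k h, NP n k = NP n h ↔ k ≡ h [MOD 2 ^ (n - 2)]) ∧
    (∀ k h, NM n k = NM n h ↔ k ≡ h [MOD 2 ^ (n - 2)]) ∧
    (∀ u v k h, 2 ≤ u → u ≤ n → 2 ≤ v → v ≤ n →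
      (NC n u k = NC n v h ↔ u = v ∧ k ≡ h [MOD 2 ^ (n - u - 1)])) ∧
    -- sizes of the cliques
    (N1 n ∈ cliqueH n ∧ N2 n ∈ cliqueH n ∧ (cliqueH n).ncard = 2 ^ (n - ceilHalf n)) ∧
    (∀ k, (cliqueS n k).ncard = 4) ∧
    (∀ u t, 2 ≤ u → u < ceilHalf n → t < 2 ^ (n - 2 * u - 1) →
      (cliqueA n u t).ncard = 2 ^ u) ∧
    -- the edges
    (∀ N M : regularSubgroups (C n), (localNormalizingGraph (C n)).Adj N M ↔
      N ≠ M ∧ ∃ K ∈ cliques n, N.1 ∈ K ∧ M.1 ∈ K) := by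
  refine ⟨isGammaFunction_all hn, regularSubgroups_eq hn, fun u k hu _ => isCyclic_NC hn hu k,
    NC_top hn, NC_pred hn, nodup_exceptional hn, pairwise_disjoint_families hn, NP_eq_NP_iff hn,
    NM_eq_NM_iff hn, fun u v k h hu hun hv hvn => NC_eq_NC_iff hn k h hu hun hv hvn,
    ⟨N1_mem_cliqueH hn, N2_mem_cliqueH hn, ncard_cliqueH hn⟩, ncard_cliqueS hn,
    fun u t hu huh ht => ncard_cliqueA hn hu huh ht, adj_iff hn⟩
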